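/- Let $n,q,K\ge 1$ and let $X_1,\dots,X_n$ be independent random vectors with $X_i\sim\mathcal N(\mu_i,\sigma^2\mathbf I_q)$ in $\mathbb R^q$, where $\mu_1,\dots,\mu_n\in\mathbb R^q$ and $\sigma>0$ are arbitrary (unknown). Let $X\in\mathbb R^{n\times q}$ be the matrix with rows $X_i$. Let $\mathrm{Cluster}$ be a measurable clustering procedure, which maps each $x\in\mathbb R^{n\times q}$ to a division of $[n]$ into labelled clusters $C_1,\dots,C_K$, and fix two labels $k\ne k'$. For an outcome $c=(C_1,\dots,C_K)$ of the procedure with $C_k,C_{k'}\neq\emptyset$ and $m:=|C_k|+|C_{k'}|\ge 3$, let $v=\frac{\mathbf 1_{C_k}}{|C_k|}-\frac{\mathbf 1_{C_{k'}}}{|C_{k'}|}$, let $\mathbf I_C$ be the diagonal matrix with entries $\mathbf 1\{i\in C\}$, and let $$\mathcal P_0=\frac{vv^\top}{\|v\|_2^2},\qquad \mathcal P_1=\Big(\mathbf I_{C_k}-\frac{\mathbf 1_{C_k}\mathbf 1_{C_k}^\top}{|C_k|}\Big)+\Big(\mathbf I_{C_{k'}}-\frac{\mathbf 1_{C_{k'}}\mathbf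 1_{C_{k'}}^\top}{|C_{k'}|}\Big),\qquad \mathcal P_2=\mathbf I_n-\mathcal P_0-\mathcal P_1 .$$ With the clusters of the outcome $c=\mathrm{Cluster}(X)$, which depend on the data, let $$R=(m-2)\frac{\|\mathcal P_0X\|_F^2}{\|\mathcal P_1X\|_F^2},$$ and for $r>0$ let $$x'(r)=\Big(\sqrt{\tfrac{r}{m-2+r}}\,\frac{\mathcal P_0X}{\|\mathcal P_0X\|_F}+\sqrt{\tfrac{m-2}{m-2+r}}\,\frac{\mathcal P_1X}{\|\mathcal P_1X\|_F}\Big)\sqrt{\|\mathcal P_0X\|_F^2+\|\mathcal P_1X\|_F^2}+\mathcal P_2X,$$ $$\mathcal S'=\{r>0:\mathrm{Cluster}(X)=\mathrm{Cluster}(x'(r))\}.$$ Let $H_0'(C_k,C_{k'})$ be the null hypothesis that $\mu_i=\mu_{i'}$ for all $i,i'\in C_k\cup C_{k'}$. Then the following hold. 1. Almost surely, whenever the outcome $\mathrm{Cluster}(X)$ has $C_k,C_{k'}\ne\emptyset$ and $m\ge3$ and satisfies $H_0'(C_k,C_{k'})$, the conditional distribution of $R$ given $$\mathrm{Cluster}(X),\quad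 \|\mathcal P_0X\|_F^2+\|\mathcal P_1X\|_F^2,\quad \frac{\mathcal P_0X}{\|\mathcal P_0X\|_F},\quad \frac{\mathcal P_1X}{\|\mathcal P_1X\|_F},\quad \mathcal P_2X$$ is the $\mathrm F_{q,(m-2)q}$ distribution truncated to $\mathcal S'$. 2. Consequently the p-value $P'=1-F_{\mathrm F_{q,(m-2)q}}(R;\mathcal S')$, where $F_{\mathrm F_{q,(m-2)q}}(\cdot\,;\mathcal S')$ is the CDF of an $\mathrm F_{q,(m-2)q}$ random variable truncated to $\mathcal S'$, is uniformly distributed on $[0,1]$ under $H_0'(C_k,C_{k'})$: this holds almost surely conditionally on the same variables for the outcomes in 1, and also conditionally on $\mathrm{Cluster}(X)\in A$, for every set $A$ of outcomes in 1 with $\mathbb P(\mathrm{Cluster}(X)\in A)>0$. -/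

import Mathlib

open MeasureTheory ProbabilityTheory Set

namespace ClusterTest

noncomputable section

/-! ### Chi-squared, F and truncated distributions -/

/-- The `χ²_k` distribution: the law of `‖G‖²` for a standard Gaussian vector `G` in `ℝ^k`. -/
def chiSquared (k : ℕ) : Measure ℝ :=
  (stdGaussian (EuclideanSpace ℝ (Fin k))).map (fun g => ‖g‖ ^ 2)

/-- The `F_{a,b}` distribution: the law of `(A / a) / (B / b)` for independent
`A ∼ χ²_a` and `B ∼ χ²_b`. -/
def fDist (a b : ℕ) : Measure ℝ :=
  ((chiSquared a).prod (chiSquared b)).map (fun p => (p.1 / a) / (p.2 / b))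

/-- The distribution `ν` truncated to `S`, that is, `ν(· ∩ S) / ν(S)`. -/
def truncated (ν : Measure ℝ) (S : Set ℝ) : Measure ℝ := ν[|S]

/-- The distribution function at `r` of `ν` truncated to `S`. -/
def truncatedCDF (ν : Measure ℝ) (S : Set ℝ) (r : ℝ) : ℝ := (truncated ν S).real (Iic r)

/-! ### Clusters and the three projection matrices -/

variable {n q K : ℕ}

/-- Matrices carry the product (equivalently, Borel) σ-algebra of `ℝ^{n × q}`. -/
instance matrixMeasurableSpace : MeasurableSpace (Matrix (Fin n) (Fin q) ℝ) :=
  inferInstanceAs (MeasurableSpace (Fin n → Fin q → ℝ))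

/-- An outcome of clustering `n` points into labelled clusters `C_0, …, C_{K-1}`:
`c i` is the label of point `i`. -/
abbrev Clustering (n K : ℕ) : Type := Fin n → Fin K

/-- The cluster `C_k`. -/
def cluster (c : Clustering n K) (k : Fin K) : Finset (Fin n) := Finset.univ.filter (fun i => c i = k)

/-- `m = |C_k| + |C_{k'}|`. -/
def pairSize (c : Clustering n K) (k k' : Fin K) : ℕ := (cluster c k).card + (cluster c k').card

/-- The vector `1_C`. -/
def oneVec (C : Finset (Fin n)) : Fin n → ℝ := fun i => if i ∈ C then 1 else 0

/-- The vector `v = 1_{C_k} / |C_k| - 1_{C_{k'}} / |C_{k'}|`. -/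
def diffVec (c : Clustering n K) (k k' : Fin K) : Fin n → ℝ :=
  ((cluster c k).card : ℝ)⁻¹ • oneVec (cluster c k)
    - ((cluster c k').card : ℝ)⁻¹ • oneVec (cluster c k')

/-- `P₀ = v vᵀ / ‖v‖₂²`. -/
def proj0 (c : Clustering n K) (k k' : Fin K) : Matrix (Fin n) (Fin n) ℝ :=
  (diffVec c k k' ⬝ᵥ diffVec c k k')⁻¹ • Matrix.vecMulVec (diffVec c k k') (diffVec c k k')

/-- `I_C - 1_C 1_Cᵀ / |C|`. -/
def centering (C : Finset (Fin n)) : Matrix (Fin n) (Fin n) ℝ :=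
  Matrix.diagonal (oneVec C) - (C.card : ℝ)⁻¹ • Matrix.vecMulVec (oneVec C) (oneVec C)

/-- `P₁`, the within-cluster variation in `C_k` and in `C_{k'}`. -/
def proj1 (c : Clustering n K) (k k' : Fin K) : Matrix (Fin n) (Fin n) ℝ :=
  centering (cluster c k) + centering (cluster c k')

/-- `P₂ = I - P₀ - P₁`. -/
def proj2 (c : Clustering n K) (k k' : Fin K) : Matrix (Fin n) (Fin n) ℝ :=
  1 - proj0 c k k' - proj1 c k k'

/-- The null hypothesis `H₀'`: all points of `C_k ∪ C_{k'}` have the same mean. -/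
def StrongNull (mean : Fin n → EuclideanSpace ℝ (Fin q)) (c : Clustering n K) (k k' : Fin K) :
    Prop :=
  ∀ i ∈ cluster c k ∪ cluster c k', ∀ i' ∈ cluster c k ∪ cluster c k', mean i = mean i'

/-! ### Test statistic, conditioning variables, truncation set and p-value

Here `x` is a data matrix (one row per point), `c` an outcome of the clustering procedure, and
`‖·‖` the Frobenius norm. -/

section Frobenius

attribute [local instance] Matrix.frobeniusNormedAddCommGroup

/-- The Frobenius norm. -/
def frob (A : Matrix (Fin n) (Fin q) ℝ) : ℝ := ‖A‖

theorem frob_eq_sqrt (A : Matrix (Fin n) (Fin q) ℝ) :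
    frob A = Real.sqrt (∑ i, ∑ j, A i j ^ 2) := by
  simp [frob, Matrix.frobenius_norm_def, Real.sqrt_eq_rpow]

end Frobenius

/-- `‖P₀ x‖_F² + ‖P₁ x‖_F²`. -/
def totalSq (c : Clustering n K) (k k' : Fin K) (x : Matrix (Fin n) (Fin q) ℝ) : ℝ :=
  frob (proj0 c k k' * x) ^ 2 + frob (proj1 c k k' * x) ^ 2

/-- The direction `A / ‖A‖_F`. -/
def direction (A : Matrix (Fin n) (Fin q) ℝ) : Matrix (Fin n) (Fin q) ℝ := (frob A)⁻¹ • A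

/-- `(m - 2) ‖P₀ x‖_F² / ‖P₁ x‖_F²`. -/
def ratio (c : Clustering n K) (k k' : Fin K) (x : Matrix (Fin n) (Fin q) ℝ) : ℝ :=
  ((pairSize c k k' : ℝ) - 2) * (frob (proj0 c k k' * x) ^ 2 / frob (proj1 c k k' * x) ^ 2)

/-- The perturbed data `x'(r)`. -/
def perturbed (c : Clustering n K) (k k' : Fin K) (x : Matrix (Fin n) (Fin q) ℝ) (r : ℝ) :
    Matrix (Fin n) (Fin q) ℝ :=
  let d : ℝ := (pairSize c k k' : ℝ) - 2
  Real.sqrt (totalSq c k k' x) •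
      (Real.sqrt (r / (d + r)) • direction (proj0 c k k' * x)
        + Real.sqrt (d / (d + r)) • direction (proj1 c k k' * x))
    + proj2 c k k' * x

variable (Cluster : Matrix (Fin n) (Fin q) ℝ → Clustering n K) (k k' : Fin K)

/-- The test statistic `R`, computed from the clusters found in the same data `x`. -/
def statR (x : Matrix (Fin n) (Fin q) ℝ) : ℝ := ratio (Cluster x) k k' x

/-- The truncation set `S' = {r > 0 : Cluster(x) = Cluster(x'(r))}`. -/
def truncSet (x : Matrix (Fin n) (Fin q) ℝ) : Set ℝ :=
  {r | 0 < r ∧ Cluster x = Cluster (perturbed (Cluster x) k k' x r)}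

/-- The conditioning variables: `Cluster(x)`, `‖P₀ x‖_F² + ‖P₁ x‖_F²`, `P₀ x / ‖P₀ x‖_F`,
`P₁ x / ‖P₁ x‖_F` and `P₂ x`. -/
def condVars (x : Matrix (Fin n) (Fin q) ℝ) :
    Clustering n K × ℝ × Matrix (Fin n) (Fin q) ℝ × Matrix (Fin n) (Fin q) ℝ
      × Matrix (Fin n) (Fin q) ℝ :=
  (Cluster x, totalSq (Cluster x) k k' x, direction (proj0 (Cluster x) k k' * x),
    direction (proj1 (Cluster x) k k' * x), proj2 (Cluster x) k k' * x)

/-- The reference distribution `F_{q,(m-2)q}`. -/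
def refDist (q : ℕ) (c : Clustering n K) (k k' : Fin K) : Measure ℝ :=
  fDist q ((pairSize c k k' - 2) * q)

/-- The p-value `P' = 1 - F_{F_{q,(m-2)q}}(R; S')`. -/
def pValue (x : Matrix (Fin n) (Fin q) ℝ) : ℝ :=
  1 - truncatedCDF (refDist q (Cluster x) k k') (truncSet Cluster k k' x) (statR Cluster k k' x)

/-- The outcomes `c` for which the test of `C_k` against `C_{k'}` is defined (two non-empty
clusters, `m ≥ 3` points in total) and the null hypothesis holds. -/
def NullOutcome (mean : Fin n → EuclideanSpace ℝ (Fin q)) (c : Clustering n K) : Prop :=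
  (cluster c k).Nonempty ∧ (cluster c k').Nonempty ∧ 3 ≤ pairSize c k k' ∧ StrongNull mean c k k'

/-- The data matrix whose `i`-th row is the point `X i ω`. -/
def dataMatrix {Ω : Type*} (X : Fin n → Ω → EuclideanSpace ℝ (Fin q)) (ω : Ω) :
    Matrix (Fin n) (Fin q) ℝ :=
  Matrix.of fun i j => X i ω j

end

end ClusterTest

open ClusterTest

/-! Fix an outcome `c` that satisfies the null hypothesis. The matrices P₀, P₁, P₂ are then fixed,
mutually orthogonal projections; P₀ and P₁ have ranks 1 and m - 2, and both annihilate the matrix of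
means. Hence P₀X, P₁X, P₂X are independent, and in orthonormal coordinates P₀X and P₁X are σ times
standard Gaussian vectors A and B of dimensions q and (m - 2)q. The length of a standard Gaussian
vector is independent of its direction (`indepFun_norm_direction`). Applied to A, to B and to the
pair (A, B), this shows that the ratio is independent of both directions and of the total squared
length. So the ratio R_c computed with the fixed `c` is F-distributed and independent of Z_c, the
remaining conditioning variables computed with `c` (`ratio_law_and_indep`).

The dependence of the clusters on the data enters only through selection. The data can be rebuilt
from (Z_c, R_c) (`perturbed_ratio`), so almost surely the event that the outcome is `c` has the form
(Z_c, R_c) ∈ S, and the slice of S at Z_c is the truncation set S' on this event. Restricting a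
product law to S truncates its second factor to the slices of S, which gives the conditional law
(`condDistrib_of_selection`). There are finitely many outcomes, so they can be treated one at a
time.

For the p-value, the F distribution has no atoms and the selected slices almost surely have positive
mass (`ae_slice_ne_zero`), so the probability integral transform applies to the truncated law
(`map_one_sub_cdf`). The resulting conditional law is the same uniform law for all these outcomes,
so it persists after averaging over any set of them (`hasLaw_cond_of_condDistrib`). -/

namespace ClusterTest

/-! ### Radial density of the standard Gaussian; independence of length and direction. -/

section Gaussian

variable {E : Type*} [NormedAddCommGroup E] [InnerProductSpace ℝ E] [FiniteDimensional ℝ E]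
  [MeasurableSpace E] [BorelSpace E]

/-- The normalised radial density of the standard Gaussian measure. -/
noncomputable def gaussianRadial (d : ℕ) (r : ℝ) : ℝ :=
  ((2 * Real.pi) ^ (d / 2 : ℝ))⁻¹ * Real.exp (-r ^ 2 / 2)

theorem measurable_gaussianRadial (d : ℕ) : Measurable (gaussianRadial d) := by
  unfold gaussianRadial; fun_prop

theorem gaussianRadial_nonneg (d : ℕ) (r : ℝ) : 0 ≤ gaussianRadial d r := by
  unfold gaussianRadial; positivity

theorem integral_gaussianRadial_cexp (t : E) :
    ∫ x : E, (gaussianRadial (Module.finrank ℝ E) ‖x‖ : ℂ) *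
      Complex.exp (inner ℝ x t * Complex.I) = Complex.exp (-‖t‖ ^ 2 / 2) := by
  have h := GaussianFourier.integral_cexp_neg_mul_sq_norm_add (V := E) (b := (1 / 2 : ℂ))
    (by norm_num) Complex.I t
  have hpt : ∀ x : E, (gaussianRadial (Module.finrank ℝ E) ‖x‖ : ℂ) *
      Complex.exp (inner ℝ x t * Complex.I) =
      (((2 * Real.pi) ^ (Module.finrank ℝ E / 2 : ℝ))⁻¹ : ℝ) *
        Complex.exp (-(1 / 2 : ℂ) * ‖x‖ ^ 2 + Complex.I * inner ℝ t x) := by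
    intro x
    rw [gaussianRadial, Complex.exp_add, real_inner_comm]
    push_cast
    rw [mul_assoc]
    congr 2
    · congr 1; ring
    · congr 1; ring
  simp_rw [hpt]
  rw [integral_const_mul, h]
  have hpi : (0 : ℝ) < 2 * Real.pi := by positivity
  have : ((Real.pi : ℂ) / (1 / 2)) ^ (Module.finrank ℝ E / 2 : ℂ) =
      (((2 * Real.pi) ^ (Module.finrank ℝ E / 2 : ℝ) : ℝ) : ℂ) := by
    rw [Complex.ofReal_cpow hpi.le]
    push_cast
    congr 1
    ring
  rw [this, ← mul_assoc, ← Complex.ofReal_mul, inv_mul_cancel₀ (by positivity)]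
  simp only [Complex.ofReal_one, one_mul, Complex.I_sq]
  congr 1
  ring

theorem integrable_gaussianRadial_norm :
    Integrable (fun x : E => gaussianRadial (Module.finrank ℝ E) ‖x‖) := by
  have h := (GaussianFourier.integrable_cexp_neg_mul_sq_norm_add (V := E) (b := (1 / 2 : ℂ))
    (by norm_num) 0 0).norm
  unfold gaussianRadial
  refine Integrable.const_mul (h.congr (Filter.Eventually.of_forall fun x => ?_)) _
  simp only [zero_mul, add_zero, Complex.norm_exp]
  congr 1
  rw [← Complex.ofReal_pow, ← Complex.ofReal_one, ← Complex.ofReal_ofNat, ← Complex.ofReal_div,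
    ← Complex.ofReal_neg, ← Complex.ofReal_mul, Complex.ofReal_re]
  ring

/-- Both measures have characteristic function exp(-‖t‖²/2). The density is needed because it makes
the radial symmetry visible. -/
theorem stdGaussian_eq_withDensity :
    stdGaussian E = volume.withDensity
      (fun x => ENNReal.ofReal (gaussianRadial (Module.finrank ℝ E) ‖x‖)) := by
  have hm : Measurable (fun x : E => gaussianRadial (Module.finrank ℝ E) ‖x‖) :=
    (measurable_gaussianRadial _).comp measurable_norm
  have : IsFiniteMeasure (volume.withDensity
      (fun x : E => ENNReal.ofReal (gaussianRadial (Module.finrank ℝ E) ‖x‖))) :=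
    isFiniteMeasure_withDensity_ofReal integrable_gaussianRadial_norm.2
  apply Measure.ext_of_charFun
  ext t
  rw [charFun_stdGaussian, charFun_apply, integral_withDensity_eq_integral_toReal_smul
    hm.ennreal_ofReal (Filter.Eventually.of_forall fun _ => ENNReal.ofReal_lt_top),
    ← integral_gaussianRadial_cexp]
  refine integral_congr_ae (Filter.Eventually.of_forall fun x => ?_)
  simp [ENNReal.toReal_ofReal (gaussianRadial_nonneg _ _)]

theorem stdGaussian_absolutelyContinuous : stdGaussian E ≪ volume := by
  rw [stdGaussian_eq_withDensity]
  exact withDensity_absolutelyContinuous _ _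

/-- Polar coordinates identify the complement of the origin with sphere × (0, ∞) and turn Lebesgue
measure into a product; the origin is a null set because the space is nontrivial. -/
theorem lintegral_polar (f : ℝ → ENNReal) (g : E → ENNReal) (hf : Measurable f)
    (hg : Measurable g) [Nontrivial E] :
    ∫⁻ x : E, f ‖x‖ * g (‖x‖⁻¹ • x) =
      (∫⁻ u, g (u : Metric.sphere (0 : E) 1) ∂(volume : Measure E).toSphere) *
        ∫⁻ r, f (r : Ioi (0 : ℝ)) ∂Measure.volumeIoiPow (Module.finrank ℝ E - 1) := by
  have hmp := (volume : Measure E).measurePreserving_homeomorphUnitSphereProd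
  rw [← lintegral_prod_mul (f := fun u : Metric.sphere (0 : E) 1 => g u)
    (g := fun r : Ioi (0 : ℝ) => f r) (by fun_prop) (by fun_prop),
    ← hmp.lintegral_comp (by fun_prop)]
  have hne : ∫⁻ x : E, f ‖x‖ * g (‖x‖⁻¹ • x) =
      ∫⁻ x in ({0}ᶜ : Set E), f ‖x‖ * g (‖x‖⁻¹ • x) := by
    rw [restrict_compl_singleton]
  rw [hne, ← lintegral_subtype_comap (measurableSet_singleton _).compl]
  refine lintegral_congr fun x => ?_
  simp [mul_comm]

/-- The density depends on the length alone, so in polar coordinates the Gaussian measure is a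
product of a spherical and a radial measure. -/
theorem indepFun_norm_direction [Nontrivial E] :
    IndepFun (fun x : E => ‖x‖) (fun x : E => ‖x‖⁻¹ • x) (stdGaussian E) := by
  set h : ℝ → ENNReal := fun r => ENNReal.ofReal (gaussianRadial (Module.finrank ℝ E) r) with hh
  have hhm : Measurable h := (measurable_gaussianRadial _).ennreal_ofReal
  set a : Set ℝ → ENNReal := fun S =>
    ∫⁻ r, S.indicator h (r : Ioi (0 : ℝ)) ∂Measure.volumeIoiPow (Module.finrank ℝ E - 1)
  set b : Set E → ENNReal := fun T =>
    ∫⁻ u, T.indicator 1 (u : Metric.sphere (0 : E) 1) ∂(volume : Measure E).toSphere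
  -- The factors `a` and `b` are not normalised; the case of two full sets gives `b univ * a univ =
  -- 1`, which is all that independence requires.
  have key : ∀ S T, MeasurableSet S → MeasurableSet T →
      stdGaussian E ((fun x : E => ‖x‖) ⁻¹' S ∩ (fun x : E => ‖x‖⁻¹ • x) ⁻¹' T) = b T * a S := by
    intro S T hS hT
    have hms : MeasurableSet ((fun x : E => ‖x‖) ⁻¹' S ∩ (fun x : E => ‖x‖⁻¹ • x) ⁻¹' T) :=
      (measurable_norm hS).inter ((by fun_prop : Measurable fun x : E => ‖x‖⁻¹ • x) hT)
    rw [stdGaussian_eq_withDensity, withDensity_apply _ hms, ← lintegral_indicator hms,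
      ← lintegral_polar _ _ (hhm.indicator hS) (measurable_one.indicator hT)]
    refine lintegral_congr fun x => ?_
    by_cases h1 : ‖x‖ ∈ S <;> by_cases h2 : ‖x‖⁻¹ • x ∈ T <;> simp [indicator, h1, h2, hh]
  rw [indepFun_iff_measure_inter_preimage_eq_mul]
  intro S T hS hT
  have h1 := key univ univ .univ .univ
  have h2 := key S univ hS .univ
  have h3 := key univ T .univ hT
  simp only [preimage_univ, inter_univ, univ_inter, measure_univ] at h1 h2 h3
  rw [key S T hS hT, h2, h3, mul_mul_mul_comm, mul_comm (b univ), mul_mul_mul_comm, ← h1, mul_one]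

end Gaussian

/-! ### Regrouping independent variables. -/

section Independence

variable {Ω α β γ : Type*} [MeasurableSpace Ω] [MeasurableSpace α] [MeasurableSpace β]
  [MeasurableSpace γ] {P : Measure Ω} [IsProbabilityMeasure P]

/-- The two hypotheses make the joint law of the triple a product of three marginals, and that
product may be reassociated. -/
theorem indepFun_prodMk_of_indepFun_prodMk {X : Ω → α} {Y : Ω → β} {W : Ω → γ}
    (hX : AEMeasurable X P) (hY : AEMeasurable Y P) (hW : AEMeasurable W P)
    (h : IndepFun X (fun ω => (Y ω, W ω)) P) (h' : IndepFun Y W P) :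
    IndepFun (fun ω => (X ω, Y ω)) W P := by
  have hXY : IndepFun X Y P := h.comp measurable_id measurable_fst
  have := Measure.isProbabilityMeasure_map hX
  have := Measure.isProbabilityMeasure_map hY
  have := Measure.isProbabilityMeasure_map hW
  rw [indepFun_iff_map_prod_eq_prod_map_map (hX.prodMk hY) hW,
    (indepFun_iff_map_prod_eq_prod_map_map hX hY).1 hXY]
  rw [indepFun_iff_map_prod_eq_prod_map_map hX (hY.prodMk hW),
    (indepFun_iff_map_prod_eq_prod_map_map hY hW).1 h'] at h
  have e : (fun ω => ((X ω, Y ω), W ω)) =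
      MeasurableEquiv.prodAssoc.symm ∘ fun ω => (X ω, (Y ω, W ω)) := rfl
  rw [e, ← AEMeasurable.map_map_of_aemeasurable (by fun_prop) (hX.prodMk (hY.prodMk hW)), h]
  rw [← (measurePreserving_prodAssoc (P.map X) (P.map Y) (P.map W)).symm.map_eq]

end Independence

/-! ### Probability integral transform for atomless laws. -/

section ProbabilityIntegralTransform

/-- Without atoms the distribution function is continuous and attains every level u in (0, 1) at
some r, where the tail beyond r has mass 1 - u. It may be flat, so superlevel sets are only compared
with such tails: the strict one lies inside the tail, the weak one contains it. -/
theorem map_one_sub_cdf (ν : Measure ℝ) [IsProbabilityMeasure ν] [NullSingletonClass ν] :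
    ν.map (fun r => 1 - ν.real (Iic r)) = volume.restrict (Icc (0 : ℝ) 1) := by
  have hF : (fun r => ν.real (Iic r)) = cdf ν := by ext r; rw [cdf_eq_real]
  have hmono : Monotone fun r => ν.real (Iic r) := by rw [hF]; exact monotone_cdf ν
  have hm : Measurable fun r => ν.real (Iic r) := hmono.measurable
  have hcont : Continuous fun r => ν.real (Iic r) := by
    rw [hF, continuous_iff_continuousAt]
    intro x
    rw [(monotone_cdf ν).continuousAt_iff_leftLim_eq_rightLim, (cdf ν).rightLim_eq]
    have := (cdf ν).measure_singleton x
    rw [measure_cdf, measure_singleton] at this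
    have h1 := ENNReal.ofReal_eq_zero.1 this.symm
    exact le_antisymm ((monotone_cdf ν).leftLim_le le_rfl) (by linarith)
  have hlevel : ∀ u ∈ Ioo (0 : ℝ) 1, ∃ r, ν.real (Iic r) = u := by
    intro u hu
    refine mem_range_of_exists_le_of_exists_ge hcont ?_ ?_
    · simp only [← cdf_eq_real]
      exact ((tendsto_cdf_atBot ν).eventually_le_const hu.1).exists
    · simp only [← cdf_eq_real]
      exact ((tendsto_cdf_atTop ν).eventually_const_le hu.2).exists
  have hupper : ∀ u ∈ Ioo (0 : ℝ) 1, ν {r | u < ν.real (Iic r)} ≤ ENNReal.ofReal (1 - u) := by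
    intro u hu
    obtain ⟨r, hr⟩ := hlevel u hu
    have hsub : {r' | u < ν.real (Iic r')} ⊆ Ioi r := by
      intro r' hr'
      by_contra hle
      have := hmono (not_lt.1 hle)
      simp only [mem_ofPred_eq] at hr' this
      linarith
    refine (measure_mono hsub).trans ?_
    rw [← compl_Iic, ← ofReal_measureReal, probReal_compl_eq_one_sub measurableSet_Iic, hr]
  have hlower : ∀ u ∈ Ioo (0 : ℝ) 1, ENNReal.ofReal (1 - u) ≤ ν {r | u ≤ ν.real (Iic r)} := by
    intro u hu
    obtain ⟨r, hr⟩ := hlevel u hu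
    have hsub : Ioi r ⊆ {r' | u ≤ ν.real (Iic r')} := fun r' hr' => by
      rw [mem_ofPred_eq, ← hr]; exact hmono (le_of_lt hr')
    refine le_trans ?_ (measure_mono hsub)
    rw [← compl_Iic, ← ofReal_measureReal, probReal_compl_eq_one_sub measurableSet_Iic, hr]
  have : IsProbabilityMeasure (ν.map (fun r => 1 - ν.real (Iic r))) :=
    Measure.isProbabilityMeasure_map (hm.const_sub 1).aemeasurable
  refine Measure.ext_of_Iic _ _ fun t => ?_
  rw [Measure.map_apply (hm.const_sub 1) measurableSet_Iic, Measure.restrict_apply measurableSet_Iic]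
  have hset : (fun r => 1 - ν.real (Iic r)) ⁻¹' Iic t = {r | 1 - t ≤ ν.real (Iic r)} := by
    ext r; simp only [mem_preimage, mem_Iic, mem_ofPred_eq]; constructor <;> intro h <;> linarith
  rw [hset]
  rcases lt_or_ge t 0 with ht | ht
  · have h1 : {r | 1 - t ≤ ν.real (Iic r)} = ∅ := by
      ext r
      simp only [mem_ofPred_eq, mem_empty_iff_false, iff_false, not_le]
      linarith [measureReal_le_one (μ := ν) (s := Iic r)]
    have h2 : Iic t ∩ Icc (0 : ℝ) 1 = ∅ := by
      ext r; simp only [mem_inter_iff, mem_Iic, mem_Icc, mem_empty_iff_false, iff_false]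
      rintro ⟨h, h', -⟩; linarith
    rw [h1, h2]; simp
  rcases le_or_gt 1 t with ht' | ht'
  · have h1 : {r | 1 - t ≤ ν.real (Iic r)} = univ := by
      ext r
      simp only [mem_ofPred_eq, mem_univ, iff_true]
      linarith [measureReal_nonneg (μ := ν) (s := Iic r)]
    have h2 : Iic t ∩ Icc (0 : ℝ) 1 = Icc 0 1 :=
      inter_eq_right.2 fun r hr => hr.2.trans ht'
    rw [h1, h2]; simp
  have h2 : Iic t ∩ Icc (0 : ℝ) 1 = Icc 0 t := by
    ext r; simp only [mem_inter_iff, mem_Iic, mem_Icc]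
    exact ⟨fun h => ⟨h.2.1, h.1⟩, fun h => ⟨h.2, h.1, h.2.trans ht'.le⟩⟩
  rw [h2, Real.volume_Icc, sub_zero]
  refine le_antisymm (ENNReal.le_of_forall_pos_le_add fun ε hε _ => ?_) ?_
  · rcases le_or_gt 1 (t + ε) with h | h
    · refine prob_le_one.trans ?_
      rw [← ENNReal.ofReal_coe_nnreal (p := ε), ← ENNReal.ofReal_add ht ε.coe_nonneg, ENNReal.one_le_ofReal]
      exact h
    · have hε' : (0 : ℝ) < ε := hε
      -- The upper bound concerns strict superlevel sets, so the level is lowered by ε to cover the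
      -- weak one.
      have := hupper (1 - t - ε) ⟨by linarith, by linarith⟩
      rw [← ENNReal.ofReal_coe_nnreal (p := ε), ← ENNReal.ofReal_add ht ε.coe_nonneg]
      refine le_trans (measure_mono fun r hr => ?_) (this.trans_eq (by congr 1; ring))
      simp only [mem_ofPred_eq] at hr ⊢
      linarith
  · rcases ht.eq_or_lt with rfl | ht
    · simp
    · simpa using hlower (1 - t) ⟨by linarith, by linarith⟩

end ProbabilityIntegralTransform

/-! ### Linear images, products and norms of standard Gaussian vectors. -/

section GaussianMaps

variable {E F G : Type*} [NormedAddCommGroup E] [InnerProductSpace ℝ E] [FiniteDimensional ℝ E]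
  [MeasurableSpace E] [BorelSpace E]
  [NormedAddCommGroup F] [InnerProductSpace ℝ F] [FiniteDimensional ℝ F]
  [MeasurableSpace F] [BorelSpace F]
  [NormedAddCommGroup G] [InnerProductSpace ℝ G] [FiniteDimensional ℝ G]
  [MeasurableSpace G] [BorelSpace G]

/-- The characteristic function of the image at `t` is that of the source at the adjoint image of
`t`, and it depends on the norm alone. -/
theorem stdGaussian_map_coisometry (L : E →L[ℝ] F)
    (hL : ∀ t, ‖ContinuousLinearMap.adjoint L t‖ = ‖t‖) :
    (stdGaussian E).map L = stdGaussian F := by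
  have := Measure.isProbabilityMeasure_map (μ := stdGaussian E) L.continuous.aemeasurable
  apply Measure.ext_of_charFun
  ext t
  rw [charFun_stdGaussian, ← hL, ← charFun_stdGaussian, charFun_apply, charFun_apply,
    integral_map L.continuous.aemeasurable (by fun_prop)]
  simp_rw [ContinuousLinearMap.adjoint_inner_right]

/-- The pair is jointly Gaussian, and its cross-covariance is the inner product of the adjoint
images; for Gaussian pairs, uncorrelated means independent. -/
theorem indepFun_clm_stdGaussian (L : E →L[ℝ] F) (M : E →L[ℝ] G)
    (h : ∀ x y, inner ℝ (ContinuousLinearMap.adjoint L x) (ContinuousLinearMap.adjoint M y) = 0) :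
    IndepFun L M (stdGaussian E) := by
  have hg : HasGaussianLaw (fun ω => (L ω, M ω)) (stdGaussian E) :=
    IsGaussian.hasGaussianLaw_id.map (L.prod M)
  refine hg.indepFun_of_covariance_inner fun x y => ?_
  simp_rw [← ContinuousLinearMap.adjoint_inner_left]
  rw [← covarianceBilin_apply_eq_cov IsGaussian.memLp_two_id, covarianceBilin_stdGaussian]
  exact h x y

theorem stdGaussian_map_norm_sq : (stdGaussian F).map (fun g => ‖g‖ ^ 2) =
    chiSquared (Module.finrank ℝ F) := by
  rw [chiSquared, ← stdGaussian_map (stdOrthonormalBasis ℝ F).repr,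
    Measure.map_map (by fun_prop) (by fun_prop)]
  congr 1
  ext g
  simp

theorem stdGaussian_prod : ((stdGaussian F).prod (stdGaussian G)).map (WithLp.toLp 2) =
    stdGaussian (WithLp 2 (F × G)) := by
  have : IsProbabilityMeasure (((stdGaussian F).prod (stdGaussian G)).map (WithLp.toLp 2)) :=
    Measure.isProbabilityMeasure_map (by fun_prop)
  apply Measure.ext_of_charFun
  ext t
  rw [charFun_prod, charFun_stdGaussian, charFun_stdGaussian, charFun_stdGaussian,
    ← Complex.exp_add, ← Complex.ofReal_pow, ← Complex.ofReal_pow, ← Complex.ofReal_pow,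
    WithLp.prod_norm_sq_eq_of_L2]
  congr 1
  push_cast
  simp only [WithLp.ofLp_fst, WithLp.ofLp_snd]
  ring

theorem ae_ne_zero_of_hasLaw {Ω : Type*} [MeasurableSpace Ω] {P : Measure Ω} {A : Ω → F}
    [Nontrivial F] (hA : HasLaw A (stdGaussian F) P) : ∀ᵐ ω ∂P, A ω ≠ 0 := by
  have h : ∀ᵐ x ∂P.map A, x ≠ 0 := by
    rw [hA.map_eq, ae_iff]
    exact stdGaussian_absolutelyContinuous (by simp)
  exact ae_of_ae_map hA.aemeasurable h

end GaussianMaps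

/-! ### The χ² and F distributions have no atoms. -/

section NoAtoms

instance isProbabilityMeasure_chiSquared (k : ℕ) : IsProbabilityMeasure (chiSquared k) :=
  Measure.isProbabilityMeasure_map (by fun_prop)

instance isProbabilityMeasure_fDist (a b : ℕ) : IsProbabilityMeasure (fDist a b) :=
  Measure.isProbabilityMeasure_map (by fun_prop)

/-- Level sets of the norm are spheres, which are Lebesgue null in positive dimension; for `k = 0`
the law is a point mass at 0. -/
theorem chiSquared_singleton {k : ℕ} (hk : k ≠ 0) (r : ℝ) : chiSquared k {r} = 0 := by
  have : NeZero k := ⟨hk⟩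
  rw [chiSquared, Measure.map_apply (by fun_prop) (measurableSet_singleton r)]
  refine stdGaussian_absolutelyContinuous (measure_mono_null (t := Metric.sphere 0 (√r)) ?_
    (Measure.addHaar_sphere _ _ _))
  intro g hg
  simp only [mem_preimage, mem_singleton_iff] at hg
  simp [← hg]

/-- By Fubini: once a nonzero denominator is fixed, a given value of the ratio determines the
numerator. The swap makes the denominator the outer variable. -/
theorem fDist_singleton {a b : ℕ} (ha : a ≠ 0) (hb : b ≠ 0) (r : ℝ) : fDist a b {r} = 0 := by
  have hm : MeasurableSet ((fun p : ℝ × ℝ => (p.1 / a) / (p.2 / b)) ⁻¹' {r}) :=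
    (by fun_prop : Measurable fun p : ℝ × ℝ => (p.1 / a) / (p.2 / b)) (measurableSet_singleton r)
  have hm' := measurable_swap hm
  rw [fDist, Measure.map_apply (by fun_prop) (measurableSet_singleton r), ← Measure.prod_swap,
    Measure.map_apply measurable_swap hm, Measure.measure_prod_null hm']
  have h0 : ∀ᵐ y ∂chiSquared b, y ≠ 0 := by
    rw [ae_iff]; simpa using chiSquared_singleton hb 0
  filter_upwards [h0] with y hy
  refine measure_mono_null (t := {r * (y / b) * a}) ?_ (chiSquared_singleton ha _)
  intro x hx
  have ha' : (a : ℝ) ≠ 0 := by exact_mod_cast ha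
  have hb' : (b : ℝ) ≠ 0 := by exact_mod_cast hb
  simp only [mem_preimage, Prod.swap_prod_mk, mem_singleton_iff] at hx ⊢
  rw [← hx]
  field_simp

theorem nullSingletonClass_fDist {a b : ℕ} (ha : a ≠ 0) (hb : b ≠ 0) :
    NullSingletonClass (fDist a b) :=
  ⟨fDist_singleton ha hb⟩

end NoAtoms

/-! ### Law and independence of the ratio of two squared Gaussian lengths. -/

section Ratio

variable {F G : Type*}
  [NormedAddCommGroup F] [InnerProductSpace ℝ F] [FiniteDimensional ℝ F]
  [MeasurableSpace F] [BorelSpace F]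
  [NormedAddCommGroup G] [InnerProductSpace ℝ G] [FiniteDimensional ℝ G]
  [MeasurableSpace G] [BorelSpace G]
  {Ω γ : Type*} [MeasurableSpace Ω] [MeasurableSpace γ] {P : Measure Ω} [IsProbabilityMeasure P]
  {A : Ω → F} {B : Ω → G} {C : Ω → γ}

theorem indepFun_norm_direction_of_hasLaw [Nontrivial F] (hA : HasLaw A (stdGaussian F) P) :
    IndepFun (fun ω => ‖A ω‖) (fun ω => ‖A ω‖⁻¹ • A ω) P := by
  have h := indepFun_norm_direction (E := F)
  have hA' := hA.aemeasurable
  rw [indepFun_iff_map_prod_eq_prod_map_map (by fun_prop) (by fun_prop), ← hA.map_eq,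
    AEMeasurable.map_map_of_aemeasurable (by fun_prop) hA',
    AEMeasurable.map_map_of_aemeasurable (by fun_prop) hA',
    AEMeasurable.map_map_of_aemeasurable (by fun_prop) hA'] at h
  exact (indepFun_iff_map_prod_eq_prod_map_map (by fun_prop) (by fun_prop)).2 h

theorem hasLaw_toLp_stdGaussian (hA : HasLaw A (stdGaussian F) P) (hB : HasLaw B (stdGaussian G) P)
    (hAB : IndepFun A B P) :
    HasLaw (fun ω => WithLp.toLp 2 (A ω, B ω)) (stdGaussian (WithLp 2 (F × G))) P where
  aemeasurable := by
    have := hA.aemeasurable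
    have := hB.aemeasurable
    fun_prop
  map_eq := by
    have hA' := hA.aemeasurable
    have hB' := hB.aemeasurable
    rw [← stdGaussian_prod, ← hA.map_eq, ← hB.map_eq,
      ← (indepFun_iff_map_prod_eq_prod_map_map hA' hB').1 hAB,
      AEMeasurable.map_map_of_aemeasurable (by fun_prop) (by fun_prop)]
    rfl

/-- Two lengths and two directions are mutually independent; the proof regroups them one variable at
a time. -/
theorem indepFun_norms_directions [Nontrivial F] [Nontrivial G]
    (hA : HasLaw A (stdGaussian F) P)
    (hB : HasLaw B (stdGaussian G) P) (hAB : IndepFun A B P) :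
    IndepFun (fun ω => (‖B ω‖⁻¹ • B ω, ‖A ω‖⁻¹ • A ω)) (fun ω => (‖B ω‖, ‖A ω‖)) P := by
  have hA' := hA.aemeasurable
  have hB' := hB.aemeasurable
  have h1 : IndepFun (fun ω => (A ω, ‖B ω‖)) (fun ω => ‖B ω‖⁻¹ • B ω) P := by
    refine indepFun_prodMk_of_indepFun_prodMk hA' (by fun_prop) (by fun_prop) ?_
      (indepFun_norm_direction_of_hasLaw hB)
    exact hAB.comp (φ := id) (ψ := fun b => (‖b‖, ‖b‖⁻¹ • b)) measurable_id (by fun_prop)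
  have h2 : IndepFun (fun ω => (‖B ω‖, ‖A ω‖)) (fun ω => ‖A ω‖⁻¹ • A ω) P := by
    refine indepFun_prodMk_of_indepFun_prodMk (by fun_prop) (by fun_prop) (by fun_prop) ?_
      (indepFun_norm_direction_of_hasLaw hA)
    exact hAB.symm.comp (φ := fun b => ‖b‖) (ψ := fun a => (‖a‖, ‖a‖⁻¹ • a))
      (by fun_prop) (by fun_prop)
  refine indepFun_prodMk_of_indepFun_prodMk (by fun_prop) (by fun_prop) (by fun_prop) ?_ h2.symm
  exact h1.symm.comp (φ := id) (ψ := fun p : F × ℝ => (‖p.1‖⁻¹ • p.1, (p.2, ‖p.1‖)))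
    measurable_id (by fun_prop)

theorem indepFun_ratio [Nontrivial F] [Nontrivial G] (hA : HasLaw A (stdGaussian F) P) (hB : HasLaw B (stdGaussian G) P)
    (hC : AEMeasurable C P) (hAB : IndepFun A B P) (hCAB : IndepFun C (fun ω => (A ω, B ω)) P) :
    IndepFun (fun ω => (C ω, (‖A ω‖ ^ 2 + ‖B ω‖ ^ 2, (‖B ω‖⁻¹ • B ω, ‖A ω‖⁻¹ • A ω))))
      (fun ω => ‖A ω‖ ^ 2 / ‖B ω‖ ^ 2) P := by
  have hA' := hA.aemeasurable
  have hB' := hB.aemeasurable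
  have hdir : IndepFun (fun ω => (‖B ω‖⁻¹ • B ω, ‖A ω‖⁻¹ • A ω))
      (fun ω => ‖A ω‖ ^ 2 / ‖B ω‖ ^ 2) P :=
    (indepFun_norms_directions hA hB hAB).comp (φ := id) (ψ := fun p : ℝ × ℝ => p.2 ^ 2 / p.1 ^ 2)
      measurable_id (by fun_prop)
  have hG := indepFun_norm_direction_of_hasLaw (hasLaw_toLp_stdGaussian hA hB hAB)
  -- The total is the squared length of the combined Gaussian vector (A, B), while the two
  -- directions and the ratio are invariant under positive scaling and hence functions of its
  -- direction.
  have htot : IndepFun (fun ω => ‖A ω‖ ^ 2 + ‖B ω‖ ^ 2)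
      (fun ω => ((‖B ω‖⁻¹ • B ω, ‖A ω‖⁻¹ • A ω), ‖A ω‖ ^ 2 / ‖B ω‖ ^ 2)) P := by
    have h := hG.comp (φ := fun r : ℝ => r ^ 2)
      (ψ := fun g : WithLp 2 (F × G) =>
        ((‖g.snd‖⁻¹ • g.snd, ‖g.fst‖⁻¹ • g.fst), ‖g.fst‖ ^ 2 / ‖g.snd‖ ^ 2))
      (by fun_prop) (by fun_prop)
    convert h using 1
    · ext ω
      simp [WithLp.prod_norm_sq_eq_of_L2]
    · ext1 ω
      simp only [Function.comp_apply]
      set g : WithLp 2 (F × G) := WithLp.toLp 2 (A ω, B ω)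
      have hg : 0 ≤ ‖g‖⁻¹ := inv_nonneg.2 (norm_nonneg g)
      by_cases h0 : ‖g‖ = 0
      · have hg0 : g = 0 := norm_eq_zero.1 h0
        have h1 : A ω = 0 := congrArg WithLp.fst hg0
        have h2 : B ω = 0 := congrArg WithLp.snd hg0
        simp [h1, h2, hg0]
      · have e1 : (‖g‖⁻¹ • g).fst = ‖g‖⁻¹ • A ω := rfl
        have e2 : (‖g‖⁻¹ • g).snd = ‖g‖⁻¹ • B ω := rfl
        rw [e1, e2, norm_smul, norm_smul, Real.norm_of_nonneg hg, mul_inv, mul_inv, inv_inv,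
          smul_smul, smul_smul, mul_right_comm, mul_inv_cancel₀ h0, one_mul, mul_right_comm,
          mul_inv_cancel₀ h0, one_mul, mul_pow, mul_pow, mul_div_mul_left]
        exact pow_ne_zero _ (inv_ne_zero h0)
  have h2 := indepFun_prodMk_of_indepFun_prodMk (by fun_prop) (by fun_prop) (by fun_prop) htot hdir
  refine indepFun_prodMk_of_indepFun_prodMk hC (by fun_prop) (by fun_prop) ?_ h2
  exact hCAB.comp (φ := id)
    (ψ := fun p : F × G => ((‖p.1‖ ^ 2 + ‖p.2‖ ^ 2, (‖p.2‖⁻¹ • p.2, ‖p.1‖⁻¹ • p.1)),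
      ‖p.1‖ ^ 2 / ‖p.2‖ ^ 2)) measurable_id (by fun_prop)

theorem hasLaw_ratio (hA : HasLaw A (stdGaussian F) P) (hB : HasLaw B (stdGaussian G) P)
    (hAB : IndepFun A B P) :
    HasLaw (fun ω => (‖A ω‖ ^ 2 / Module.finrank ℝ F) / (‖B ω‖ ^ 2 / Module.finrank ℝ G))
      (fDist (Module.finrank ℝ F) (Module.finrank ℝ G)) P where
  aemeasurable := by
    have := hA.aemeasurable
    have := hB.aemeasurable
    fun_prop
  map_eq := by
    have hA' := hA.aemeasurable
    have hB' := hB.aemeasurable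
    rw [fDist, ← stdGaussian_map_norm_sq, ← stdGaussian_map_norm_sq, ← hA.map_eq, ← hB.map_eq,
      AEMeasurable.map_map_of_aemeasurable (by fun_prop) hA',
      AEMeasurable.map_map_of_aemeasurable (by fun_prop) hB',
      ← (indepFun_iff_map_prod_eq_prod_map_map (by fun_prop) (by fun_prop)).1
        (hAB.comp (φ := fun a => ‖a‖ ^ 2) (ψ := fun b => ‖b‖ ^ 2) (by fun_prop) (by fun_prop)),
      AEMeasurable.map_map_of_aemeasurable (by fun_prop) (by fun_prop)]
    rfl

end Ratio

/-! ### Algebra of the projections P₀, P₁, P₂ and their action on the means. -/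

section Projections

variable {n q K : ℕ}

theorem oneVec_mul_self (C : Finset (Fin n)) (i : Fin n) :
    oneVec C i * oneVec C i = oneVec C i := by
  simp [oneVec]

theorem oneVec_mul_of_disjoint {C C' : Finset (Fin n)} (h : Disjoint C C') (i : Fin n) :
    oneVec C i * oneVec C' i = 0 := by
  have h' : i ∈ C → i ∉ C' := fun hi => Finset.disjoint_left.1 h hi
  by_cases h1 : i ∈ C
  · simp [oneVec, h' h1]
  · simp [oneVec, h1]

theorem sum_oneVec (C : Finset (Fin n)) : ∑ i, oneVec C i = C.card := by
  simp [oneVec]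

theorem oneVec_dotProduct_self (C : Finset (Fin n)) : oneVec C ⬝ᵥ oneVec C = C.card := by
  simp_rw [dotProduct, oneVec_mul_self, sum_oneVec]

theorem oneVec_dotProduct_of_disjoint {C C' : Finset (Fin n)} (h : Disjoint C C') :
    oneVec C ⬝ᵥ oneVec C' = 0 := by
  simp_rw [dotProduct, oneVec_mul_of_disjoint h, Finset.sum_const_zero]

theorem diagonal_mulVec_oneVec (C : Finset (Fin n)) :
    (Matrix.diagonal (oneVec C)).mulVec (oneVec C) = oneVec C := by
  ext i; rw [Matrix.mulVec_diagonal, oneVec_mul_self]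

theorem centering_transpose (C : Finset (Fin n)) : (centering C).transpose = centering C := by
  simp [centering, Matrix.transpose_vecMulVec]

theorem centering_mulVec_oneVec {C : Finset (Fin n)} (hC : C.Nonempty) :
    (centering C).mulVec (oneVec C) = 0 := by
  have h : (C.card : ℝ) ≠ 0 := by exact_mod_cast hC.card_ne_zero
  rw [centering, Matrix.sub_mulVec, diagonal_mulVec_oneVec, Matrix.smul_mulVec,
    Matrix.vecMulVec_mulVec, oneVec_dotProduct_self]
  ext i
  simp only [Pi.sub_apply, Pi.smul_apply, Pi.zero_apply, smul_eq_mul, MulOpposite.smul_eq_mul_unop,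
    MulOpposite.unop_op]
  field_simp
  ring

theorem centering_mulVec_oneVec_of_disjoint {C C' : Finset (Fin n)} (h : Disjoint C C') :
    (centering C).mulVec (oneVec C') = 0 := by
  rw [centering, Matrix.sub_mulVec, Matrix.smul_mulVec,
    Matrix.vecMulVec_mulVec, oneVec_dotProduct_of_disjoint h]
  ext i
  simp [Matrix.mulVec_diagonal, oneVec_mul_of_disjoint h]

theorem centering_mul_self {C : Finset (Fin n)} (hC : C.Nonempty) :
    centering C * centering C = centering C := by
  conv_lhs => rhs; rw [centering]
  rw [Matrix.mul_sub, Matrix.mul_smul, Matrix.mul_vecMulVec, centering_mulVec_oneVec hC,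
    Matrix.zero_vecMulVec, smul_zero, sub_zero, centering, Matrix.sub_mul, Matrix.smul_mul,
    Matrix.vecMulVec_mul, Matrix.diagonal_mul_diagonal]
  simp_rw [oneVec_mul_self]
  congr 3
  ext i
  simp [Matrix.vecMul_diagonal, oneVec_mul_self]

theorem centering_mul_of_disjoint {C C' : Finset (Fin n)} (h : Disjoint C C') :
    centering C * centering C' = 0 := by
  conv_lhs => rhs; rw [centering]
  rw [Matrix.mul_sub, Matrix.mul_smul, Matrix.mul_vecMulVec,
    centering_mulVec_oneVec_of_disjoint h, Matrix.zero_vecMulVec, smul_zero, sub_zero, centering,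
    Matrix.sub_mul, Matrix.smul_mul, Matrix.vecMulVec_mul, Matrix.diagonal_mul_diagonal]
  simp_rw [oneVec_mul_of_disjoint h]
  have : Matrix.vecMul (oneVec C) (Matrix.diagonal (oneVec C')) = 0 := by
    ext i; simp [Matrix.vecMul_diagonal, oneVec_mul_of_disjoint h]
  simp [this]

theorem trace_centering {C : Finset (Fin n)} (hC : C.Nonempty) :
    (centering C).trace = C.card - 1 := by
  have h : (C.card : ℝ) ≠ 0 := by exact_mod_cast hC.card_ne_zero
  rw [centering, Matrix.trace_sub, Matrix.trace_smul, Matrix.trace_vecMulVec,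
    oneVec_dotProduct_self, Matrix.trace_diagonal, sum_oneVec, smul_eq_mul, inv_mul_cancel₀ h]

variable {c : Clustering n K} {k k' : Fin K}

theorem disjoint_cluster (h : k ≠ k') : Disjoint (cluster c k) (cluster c k') := by
  rw [Finset.disjoint_left]
  intro i h1 h2
  simp only [cluster, Finset.mem_filter] at h1 h2
  exact h (h1.2.symm.trans h2.2)

theorem proj1_transpose : (proj1 c k k').transpose = proj1 c k k' := by
  simp [proj1, centering_transpose]

theorem proj0_transpose : (proj0 c k k').transpose = proj0 c k k' := by
  simp [proj0, Matrix.transpose_vecMulVec]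

theorem proj1_mul_self (h : k ≠ k') (hk : (cluster c k).Nonempty) (hk' : (cluster c k').Nonempty) :
    proj1 c k k' * proj1 c k k' = proj1 c k k' := by
  rw [proj1, Matrix.add_mul, Matrix.mul_add, Matrix.mul_add, centering_mul_self hk,
    centering_mul_self hk', centering_mul_of_disjoint (disjoint_cluster h),
    centering_mul_of_disjoint (disjoint_cluster h.symm), add_zero, zero_add]

theorem trace_proj1 (hk : (cluster c k).Nonempty) (hk' : (cluster c k').Nonempty) :
    (proj1 c k k').trace = pairSize c k k' - 2 := by
  rw [proj1, Matrix.trace_add, trace_centering hk, trace_centering hk', pairSize]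
  push_cast
  ring

theorem diffVec_dotProduct_self_ne_zero (h : k ≠ k') (hk : (cluster c k).Nonempty)
    (hk' : (cluster c k').Nonempty) : diffVec c k k' ⬝ᵥ diffVec c k k' ≠ 0 := by
  have h0 : (0 : ℝ) < (cluster c k).card := by exact_mod_cast hk.card_pos
  have h0' : (0 : ℝ) < (cluster c k').card := by exact_mod_cast hk'.card_pos
  rw [diffVec, sub_dotProduct, dotProduct_sub, dotProduct_sub]
  simp only [smul_dotProduct, dotProduct_smul, oneVec_dotProduct_self,
    oneVec_dotProduct_of_disjoint (disjoint_cluster (c := c) h),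
    oneVec_dotProduct_of_disjoint (disjoint_cluster (c := c) h.symm), smul_eq_mul]
  rw [inv_mul_cancel₀ h0.ne', inv_mul_cancel₀ h0'.ne']
  simp only [mul_zero, mul_one, sub_zero, zero_sub, sub_neg_eq_add]
  positivity

theorem proj0_mul_self (h : k ≠ k') (hk : (cluster c k).Nonempty) (hk' : (cluster c k').Nonempty) :
    proj0 c k k' * proj0 c k k' = proj0 c k k' := by
  have h0 := diffVec_dotProduct_self_ne_zero h hk hk'
  rw [proj0, Matrix.smul_mul, Matrix.mul_smul, Matrix.vecMulVec_mul_vecMulVec,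
    Matrix.vecMulVec_smul, smul_smul (_ : ℝ)⁻¹ (_ ⬝ᵥ _), inv_mul_cancel₀ h0, one_smul]

theorem trace_proj0 (h : k ≠ k') (hk : (cluster c k).Nonempty) (hk' : (cluster c k').Nonempty) :
    (proj0 c k k').trace = 1 := by
  rw [proj0, Matrix.trace_smul, Matrix.trace_vecMulVec, smul_eq_mul,
    inv_mul_cancel₀ (diffVec_dotProduct_self_ne_zero h hk hk')]

theorem proj1_mul_proj0 (h : k ≠ k') (hk : (cluster c k).Nonempty)
    (hk' : (cluster c k').Nonempty) : proj1 c k k' * proj0 c k k' = 0 := by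
  have : (proj1 c k k').mulVec (diffVec c k k') = 0 := by
    rw [proj1, diffVec, Matrix.add_mulVec, Matrix.mulVec_sub, Matrix.mulVec_sub]
    simp only [Matrix.mulVec_smul, centering_mulVec_oneVec hk, centering_mulVec_oneVec hk',
      centering_mulVec_oneVec_of_disjoint (disjoint_cluster (c := c) h),
      centering_mulVec_oneVec_of_disjoint (disjoint_cluster (c := c) h.symm)]
    simp
  rw [proj0, Matrix.mul_smul, Matrix.mul_vecMulVec, this, Matrix.zero_vecMulVec, smul_zero]

theorem proj0_mul_proj1 (h : k ≠ k') (hk : (cluster c k).Nonempty)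
    (hk' : (cluster c k').Nonempty) : proj0 c k k' * proj1 c k k' = 0 := by
  rw [← proj0_transpose, ← proj1_transpose, ← Matrix.transpose_mul, proj1_mul_proj0 h hk hk',
    Matrix.transpose_zero]

theorem proj2_transpose : (proj2 c k k').transpose = proj2 c k k' := by
  simp [proj2, proj0_transpose, proj1_transpose]

theorem proj0_mul_proj2 (h : k ≠ k') (hk : (cluster c k).Nonempty)
    (hk' : (cluster c k').Nonempty) : proj0 c k k' * proj2 c k k' = 0 := by
  rw [proj2, Matrix.mul_sub, Matrix.mul_sub, proj0_mul_self h hk hk', proj0_mul_proj1 h hk hk']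
  simp

theorem proj1_mul_proj2 (h : k ≠ k') (hk : (cluster c k).Nonempty)
    (hk' : (cluster c k').Nonempty) : proj1 c k k' * proj2 c k k' = 0 := by
  rw [proj2, Matrix.mul_sub, Matrix.mul_sub, proj1_mul_self h hk hk', proj1_mul_proj0 h hk hk']
  simp

/-- Columns of `centering C` outside `C` vanish, so only the rows of `M` in `C` matter; there each
column of `M` is a multiple of `oneVec C`, which is annihilated. -/
theorem centering_mul_eq_zero {C : Finset (Fin n)} (hC : C.Nonempty)
    {M : Matrix (Fin n) (Fin q) ℝ} (hM : ∀ i ∈ C, ∀ i' ∈ C, M i = M i') : centering C * M = 0 := by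
  obtain ⟨i₀, hi₀⟩ := hC
  ext i j
  have hrow : ∀ l, centering C i l * M l j = (M i₀ j) * (centering C i l * oneVec C l) := by
    intro l
    by_cases hl : l ∈ C
    · rw [hM l hl i₀ hi₀]; simp [oneVec, hl, mul_comm]
    · have : centering C i l = 0 := by
        by_cases hil : i = l
        · subst hil; simp [centering, oneVec, hl, Matrix.vecMulVec_apply]
        · simp [centering, oneVec, hl, Matrix.vecMulVec_apply, hil]
      simp [this]
  rw [Matrix.mul_apply]
  simp_rw [hrow, ← Finset.mul_sum]
  have := congrFun (centering_mulVec_oneVec ⟨i₀, hi₀⟩) i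
  rw [Matrix.mulVec, dotProduct] at this
  rw [this]
  simp

theorem proj1_mul_mean {mean : Fin n → EuclideanSpace ℝ (Fin q)} (hk : (cluster c k).Nonempty)
    (hk' : (cluster c k').Nonempty) (hnull : StrongNull mean c k k') :
    proj1 c k k' * Matrix.of (fun i j => mean i j) = 0 := by
  rw [proj1, Matrix.add_mul, centering_mul_eq_zero hk, centering_mul_eq_zero hk', add_zero]
  · intro i hi i' hi'
    ext j
    simp [hnull i (Finset.mem_union_right _ hi) i' (Finset.mem_union_right _ hi')]
  · intro i hi i' hi'
    ext j
    simp [hnull i (Finset.mem_union_left _ hi) i' (Finset.mem_union_left _ hi')]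

/-- The entries of v sum to zero and are supported on the two clusters, where the mean is constant.
Here the equality of means across the two clusters is essential. -/
theorem proj0_mul_mean {mean : Fin n → EuclideanSpace ℝ (Fin q)} (hk : (cluster c k).Nonempty)
    (hk' : (cluster c k').Nonempty) (hnull : StrongNull mean c k k') :
    proj0 c k k' * Matrix.of (fun i j => mean i j) = 0 := by
  obtain ⟨i₀, hi₀⟩ := id hk
  have h0 : ((cluster c k).card : ℝ) ≠ 0 := by exact_mod_cast hk.card_ne_zero
  have h0' : ((cluster c k').card : ℝ) ≠ 0 := by exact_mod_cast hk'.card_ne_zero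
  have hsum : ∑ i, diffVec c k k' i = 0 := by
    simp only [diffVec, Pi.sub_apply, Pi.smul_apply, smul_eq_mul, Finset.sum_sub_distrib,
      ← Finset.mul_sum, sum_oneVec]
    rw [inv_mul_cancel₀ h0, inv_mul_cancel₀ h0', sub_self]
  have : Matrix.vecMul (diffVec c k k') (Matrix.of fun i j => mean i j) = 0 := by
    ext j
    have hterm : ∀ i, diffVec c k k' i * mean i j = diffVec c k k' i * mean i₀ j := by
      intro i
      by_cases hi : i ∈ cluster c k ∪ cluster c k'
      · rw [hnull i hi i₀ (Finset.mem_union_left _ hi₀)]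
      · rw [Finset.mem_union, not_or] at hi
        simp [diffVec, oneVec, hi.1, hi.2]
    simp only [Matrix.vecMul, dotProduct, Matrix.of_apply, Pi.zero_apply]
    simp_rw [hterm, ← Finset.sum_mul, hsum, zero_mul]
  rw [proj0, Matrix.smul_mul, Matrix.vecMulVec_mul, this]
  ext i j
  simp [Matrix.vecMulVec_apply]

/-- A real orthogonal projection matrix of trace `d` factors through `d` orthonormal rows. -/
theorem exists_orthonormal_rows {d : ℕ} {A : Matrix (Fin n) (Fin n) ℝ} (hs : A.transpose = A)
    (hi : A * A = A) (ht : A.trace = d) :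
    ∃ U : Matrix (Fin d) (Fin n) ℝ, U * U.transpose = 1 ∧ U.transpose * U = A := by
  set T := Matrix.toEuclideanLin A with hT
  have happ : ∀ x i, T x i = ∑ j, A i j * x j := fun x i => rfl
  have hTT : ∀ x, T (T x) = T x := by
    intro x
    have : A.mulVec (A.mulVec x.ofLp) = A.mulVec x.ofLp := by rw [Matrix.mulVec_mulVec, hi]
    exact congrArg (WithLp.toLp 2) this
  have hsym : T.IsSymmetric := by
    rw [Matrix.isSymmetric_toEuclideanLin_iff, Matrix.IsHermitian, Matrix.conjTranspose_eq_transpose_of_trivial, hs]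
  have hproj : LinearMap.IsProj (LinearMap.range T) T :=
    ⟨fun x => ⟨x, rfl⟩, by rintro _ ⟨x, rfl⟩; exact hTT x⟩
  -- The rank of a projection is its trace.
  have hd : Module.finrank ℝ (LinearMap.range T) = d := by
    have h1 := hproj.trace
    have h2 : LinearMap.trace ℝ _ T = A.trace := by
      rw [hT, Matrix.toEuclideanLin_eq_toLin_orthonormal, Matrix.trace_toLin_eq]
    rw [h2, ht] at h1
    exact_mod_cast h1.symm
  let b := (stdOrthonormalBasis ℝ (LinearMap.range T)).reindex (finCongr hd)
  have hb : ∀ l, T (b l) = b l := fun l => hproj.map_id _ (b l).2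
  refine ⟨Matrix.of fun l i => (b l : EuclideanSpace ℝ (Fin n)) i, ?_, ?_⟩
  · ext l l'
    have := orthonormal_iff_ite.1 b.orthonormal l l'
    rw [Submodule.coe_inner, PiLp.inner_apply] at this
    simp only [Matrix.mul_apply, Matrix.transpose_apply, Matrix.of_apply, Matrix.one_apply]
    rw [← this]
    simp [mul_comm]
  · ext i j
    -- Expand the projection of the j-th basis vector in `b`; by symmetry its l-th coefficient is
    -- the j-th entry of `b l`.
    have h := b.sum_repr' ⟨T (EuclideanSpace.single j 1), ⟨_, rfl⟩⟩
    have h1 := congrArg (fun y : LinearMap.range T => (y : EuclideanSpace ℝ (Fin n)) i) h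
    have h2 : ∀ l, inner ℝ (b l) (⟨T (EuclideanSpace.single j 1), ⟨_, rfl⟩⟩ : LinearMap.range T) =
        (b l : EuclideanSpace ℝ (Fin n)) j := by
      intro l
      rw [Submodule.coe_inner, ← hsym, hb, EuclideanSpace.inner_single_right]
      simp
    simp only [h2, happ] at h1
    simp only [Matrix.mul_apply, Matrix.transpose_apply, Matrix.of_apply]
    simp at h1
    rw [← h1]
    simp [mul_comm]

end Projections

/-! ### Matrices as vectors of points; measurability of matrix operations. -/

section RowMaps

variable {n p r q : ℕ}

/-- Vectors of points in `ℝ^q`, with the Euclidean norm. -/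
abbrev Points (n q : ℕ) : Type := PiLp 2 (fun _ : Fin n => EuclideanSpace ℝ (Fin q))

/-- The action of a matrix on vectors of points. -/
noncomputable def rowMap (q : ℕ) (M : Matrix (Fin p) (Fin n) ℝ) : Points n q →L[ℝ] Points p q :=
  (PiLp.continuousLinearEquiv 2 ℝ
    (fun _ : Fin p => EuclideanSpace ℝ (Fin q))).symm.toContinuousLinearMap.comp
    (ContinuousLinearMap.pi fun l =>
      ∑ i, M l i • PiLp.proj 2 (fun _ : Fin n => EuclideanSpace ℝ (Fin q)) i)

theorem rowMap_apply (M : Matrix (Fin p) (Fin n) ℝ) (x : Points n q) (l : Fin p) :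
    rowMap q M x l = ∑ i, M l i • x i := by
  simp [rowMap]

theorem adjoint_rowMap (M : Matrix (Fin p) (Fin n) ℝ) :
    ContinuousLinearMap.adjoint (rowMap q M) = rowMap q M.transpose := by
  symm
  rw [ContinuousLinearMap.eq_adjoint_iff]
  intro x y
  rw [PiLp.inner_apply, PiLp.inner_apply]
  have h1 : ∀ i, inner ℝ (rowMap q M.transpose x i) (y i) = ∑ l, M l i * inner ℝ (x l) (y i) := by
    intro i
    rw [rowMap_apply, sum_inner]
    exact Finset.sum_congr rfl fun l _ => real_inner_smul_left _ _ _
  have h2 : ∀ l, inner ℝ (x l) (rowMap q M y l) = ∑ i, M l i * inner ℝ (x l) (y i) := by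
    intro l
    rw [rowMap_apply, inner_sum]
    exact Finset.sum_congr rfl fun i _ => real_inner_smul_right _ _ _
  simp_rw [h1, h2]
  exact Finset.sum_comm

theorem rowMap_rowMap (M : Matrix (Fin r) (Fin p) ℝ) (N : Matrix (Fin p) (Fin n) ℝ)
    (x : Points n q) : rowMap q M (rowMap q N x) = rowMap q (M * N) x := by
  ext l : 1
  simp_rw [rowMap_apply, Finset.smul_sum, smul_smul, Matrix.mul_apply, Finset.sum_smul]
  rw [Finset.sum_comm]

theorem rowMap_one (x : Points n q) : rowMap q (1 : Matrix (Fin n) (Fin n) ℝ) x = x := by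
  ext l : 1
  simp [rowMap_apply, Matrix.one_apply]

theorem rowMap_zero (x : Points n q) : rowMap q (0 : Matrix (Fin p) (Fin n) ℝ) x = 0 := by
  ext l : 1
  simp [rowMap_apply]

theorem inner_rowMap_transpose (M : Matrix (Fin p) (Fin n) ℝ) (N : Matrix (Fin r) (Fin n) ℝ)
    (x : Points p q) (y : Points r q) :
    inner ℝ (rowMap q M.transpose x) (rowMap q N.transpose y) =
      inner ℝ x (rowMap q (M * N.transpose) y) := by
  rw [← adjoint_rowMap M, ContinuousLinearMap.adjoint_inner_left, rowMap_rowMap]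

/-- Orthonormal rows make the transpose an isometric embedding, so passing to coordinates in the
range of a projection preserves lengths. -/
theorem norm_rowMap_transpose {U : Matrix (Fin p) (Fin n) ℝ} (hU : U * U.transpose = 1)
    (x : Points p q) : ‖rowMap q U.transpose x‖ = ‖x‖ := by
  have h := inner_rowMap_transpose U U x x
  rw [hU, rowMap_one, real_inner_self_eq_norm_sq, real_inner_self_eq_norm_sq] at h
  exact (sq_eq_sq₀ (norm_nonneg _) (norm_nonneg _)).1 h

/-- The matrix whose rows are the given points. -/
def toMat (x : Points n q) : Matrix (Fin n) (Fin q) ℝ := Matrix.of fun i j => x i j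

theorem toMat_rowMap (M : Matrix (Fin p) (Fin n) ℝ) (x : Points n q) :
    toMat (rowMap q M x) = M * toMat x := by
  ext l j
  simp [toMat, rowMap_apply, Matrix.mul_apply]

theorem toMat_smul (a : ℝ) (x : Points n q) : toMat (a • x) = a • toMat x := by
  ext l j
  simp [toMat]

theorem frob_toMat (x : Points n q) : frob (toMat x) = ‖x‖ := by
  rw [frob_eq_sqrt, PiLp.norm_eq_of_L2]
  simp [toMat, EuclideanSpace.norm_sq_eq]

theorem measurable_toMat : Measurable (toMat : Points n q → Matrix (Fin n) (Fin q) ℝ) := by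
  refine measurable_pi_lambda _ fun i => measurable_pi_lambda _ fun j => ?_
  change Measurable fun x : Points n q => x i j
  fun_prop

theorem measurable_entry (i : Fin n) (j : Fin q) :
    Measurable (fun x : Matrix (Fin n) (Fin q) ℝ => x i j) :=
  (measurable_pi_apply j).comp
    (measurable_pi_apply (X := fun _ : Fin n => Fin q → ℝ) i)

theorem measurable_matrix_mul (M : Matrix (Fin p) (Fin n) ℝ) :
    Measurable (fun x : Matrix (Fin n) (Fin q) ℝ => M * x) := by
  refine measurable_pi_lambda _ fun i => measurable_pi_lambda _ fun j => ?_
  simp_rw [Matrix.mul_apply]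
  exact Finset.measurable_sum _ fun l _ =>
    (measurable_entry l j).const_mul _

theorem measurable_matrix_add : Measurable
    (fun x : Matrix (Fin n) (Fin q) ℝ × Matrix (Fin n) (Fin q) ℝ => x.1 + x.2) := by
  refine measurable_pi_lambda _ fun i => measurable_pi_lambda _ fun j => ?_
  change Measurable fun x : Matrix (Fin n) (Fin q) ℝ × Matrix (Fin n) (Fin q) ℝ =>
    x.1 i j + x.2 i j
  exact ((measurable_entry i j).comp measurable_fst).add
    ((measurable_entry i j).comp measurable_snd)

theorem measurable_matrix_smul : Measurable
    (fun x : ℝ × Matrix (Fin n) (Fin q) ℝ => x.1 • x.2) := by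
  refine measurable_pi_lambda _ fun i => measurable_pi_lambda _ fun j => ?_
  change Measurable fun x : ℝ × Matrix (Fin n) (Fin q) ℝ => x.1 * x.2 i j
  exact measurable_fst.mul ((measurable_entry i j).comp measurable_snd)

theorem measurable_frob : Measurable (frob : Matrix (Fin n) (Fin q) ℝ → ℝ) := by
  have : (frob : Matrix (Fin n) (Fin q) ℝ → ℝ) = fun A => √(∑ i, ∑ j, A i j ^ 2) :=
    funext frob_eq_sqrt
  rw [this]
  exact (Finset.measurable_sum _ fun i _ => Finset.measurable_sum _ fun j _ =>
    (measurable_entry i j).pow_const 2).sqrt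

theorem measurable_direction :
    Measurable (direction : Matrix (Fin n) (Fin q) ℝ → Matrix (Fin n) (Fin q) ℝ) :=
  measurable_matrix_smul.comp (measurable_frob.inv.prodMk measurable_id)

end RowMaps

/-! ### The Gaussian model for a fixed outcome. -/

section Model

variable {n q K : ℕ} {Ω : Type*} [MeasurableSpace Ω] {P : Measure Ω} [IsProbabilityMeasure P]

/-- The conditioning variables other than the outcome, for a fixed outcome `c`. -/
noncomputable def fixedVars (c : Clustering n K) (k k' : Fin K) (x : Matrix (Fin n) (Fin q) ℝ) :
    ℝ × Matrix (Fin n) (Fin q) ℝ × Matrix (Fin n) (Fin q) ℝ × Matrix (Fin n) (Fin q) ℝ :=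
  (totalSq c k k' x, direction (proj0 c k k' * x), direction (proj1 c k k' * x),
    proj2 c k k' * x)

theorem direction_eq {p : ℕ} {U : Matrix (Fin p) (Fin n) ℝ} (hU : U * U.transpose = 1) {σ : ℝ}
    (hσ : 0 < σ) (y : Points p q) : direction (σ • (U.transpose * toMat y)) =
      U.transpose * toMat (‖y‖⁻¹ • y) := by
  rw [direction, ← toMat_rowMap, ← toMat_smul, frob_toMat, norm_smul, norm_rowMap_transpose hU,
    ← toMat_rowMap, ← toMat_smul, map_smul, smul_smul, mul_inv, Real.norm_of_nonneg hσ.le,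
    mul_right_comm, inv_mul_cancel₀ hσ.ne', one_mul]

theorem frob_eq {p : ℕ} {U : Matrix (Fin p) (Fin n) ℝ} (hU : U * U.transpose = 1) {σ : ℝ}
    (hσ : 0 < σ) (y : Points p q) : frob (σ • (U.transpose * toMat y)) = σ * ‖y‖ := by
  rw [← toMat_rowMap, ← toMat_smul, frob_toMat, norm_smul, norm_rowMap_transpose hU,
    Real.norm_of_nonneg hσ.le]

theorem finrank_points (p q : ℕ) : Module.finrank ℝ (Points p q) = p * q := by
  rw [(WithLp.linearEquiv 2 ℝ (Fin p → EuclideanSpace ℝ (Fin q))).finrank_eq,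
    Module.finrank_pi_fintype]
  simp

section RowMapLaws

variable {ξ : Ω → Points n q} {p r s : ℕ}

theorem aemeasurable_rowMap {P : Measure Ω} (hξ : AEMeasurable ξ P)
    (M : Matrix (Fin p) (Fin n) ℝ) : AEMeasurable (fun ω => rowMap q M (ξ ω)) P :=
  (rowMap q M).continuous.measurable.comp_aemeasurable hξ

theorem hasLaw_rowMap {P : Measure Ω} (hξ : HasLaw ξ (stdGaussian (Points n q)) P)
    {U : Matrix (Fin p) (Fin n) ℝ} (hU : U * U.transpose = 1) :
    HasLaw (fun ω => rowMap q U (ξ ω)) (stdGaussian (Points p q)) P where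
  aemeasurable := aemeasurable_rowMap hξ.aemeasurable U
  map_eq := by
    rw [← stdGaussian_map_coisometry (rowMap q U) (fun t => by
      rw [adjoint_rowMap, norm_rowMap_transpose hU]), ← hξ.map_eq,
      AEMeasurable.map_map_of_aemeasurable (by fun_prop) hξ.aemeasurable]
    rfl

theorem indepFun_clm_of_hasLaw {E F G : Type*} [NormedAddCommGroup E] [InnerProductSpace ℝ E]
    [FiniteDimensional ℝ E] [MeasurableSpace E] [BorelSpace E] [NormedAddCommGroup F]
    [InnerProductSpace ℝ F] [FiniteDimensional ℝ F] [MeasurableSpace F] [BorelSpace F]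
    [NormedAddCommGroup G] [InnerProductSpace ℝ G] [FiniteDimensional ℝ G] [MeasurableSpace G]
    [BorelSpace G] {ξ : Ω → E} (hξ : HasLaw ξ (stdGaussian E) P) (L : E →L[ℝ] F) (M : E →L[ℝ] G)
    (h : ∀ x y,
      inner ℝ (ContinuousLinearMap.adjoint L x) (ContinuousLinearMap.adjoint M y) = 0) :
    IndepFun (fun ω => L (ξ ω)) (fun ω => M (ξ ω)) P := by
  have hξm := hξ.aemeasurable
  have h1 := indepFun_clm_stdGaussian L M h
  rw [indepFun_iff_map_prod_eq_prod_map_map (by fun_prop) (by fun_prop), ← hξ.map_eq,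
    AEMeasurable.map_map_of_aemeasurable (by fun_prop) hξm,
    AEMeasurable.map_map_of_aemeasurable (by fun_prop) hξm,
    AEMeasurable.map_map_of_aemeasurable (by fun_prop) hξm] at h1
  exact (indepFun_iff_map_prod_eq_prod_map_map (by fun_prop) (by fun_prop)).2 h1

theorem indepFun_rowMap (hξ : HasLaw ξ (stdGaussian (Points n q)) P)
    {U : Matrix (Fin p) (Fin n) ℝ} {V : Matrix (Fin r) (Fin n) ℝ} (h : U * V.transpose = 0) :
    IndepFun (fun ω => rowMap q U (ξ ω)) (fun ω => rowMap q V (ξ ω)) P :=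
  indepFun_clm_of_hasLaw hξ _ _ fun y z => by
    rw [adjoint_rowMap, adjoint_rowMap, inner_rowMap_transpose, h, rowMap_zero, inner_zero_right]

/-- Pairwise independence from `W` would not suffice, so `U` and `V` are stacked into one linear map
whose adjoint range is orthogonal to that of `W`. -/
theorem indepFun_rowMap_prodMk (hξ : HasLaw ξ (stdGaussian (Points n q)) P)
    {U : Matrix (Fin p) (Fin n) ℝ} {V : Matrix (Fin r) (Fin n) ℝ} {W : Matrix (Fin s) (Fin n) ℝ}
    (hU : U * W.transpose = 0) (hV : V * W.transpose = 0) :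
    IndepFun (fun ω => rowMap q W (ξ ω)) (fun ω => (rowMap q U (ξ ω), rowMap q V (ξ ω))) P := by
  let L : Points n q →L[ℝ] WithLp 2 (Points p q × Points r q) :=
    (WithLp.prodContinuousLinearEquiv 2 ℝ _ _).symm.toContinuousLinearMap.comp
      ((rowMap q U).prod (rowMap q V))
  have hL : IndepFun (fun ω => L (ξ ω)) (fun ω => rowMap q W (ξ ω)) P :=
    indepFun_clm_of_hasLaw hξ _ _ fun y z => by
      rw [ContinuousLinearMap.adjoint_inner_left, adjoint_rowMap]
      have : L (rowMap q W.transpose z) = 0 := by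
        change WithLp.toLp 2 (rowMap q U (rowMap q W.transpose z),
          rowMap q V (rowMap q W.transpose z)) = 0
        rw [rowMap_rowMap, rowMap_rowMap, hU, hV, rowMap_zero, rowMap_zero]
        rfl
      rw [this, inner_zero_right]
  exact (hL.comp (φ := fun g => (g.fst, g.snd)) (ψ := id) (by fun_prop) measurable_id).symm

end RowMapLaws

/-- For a fixed outcome satisfying the null hypothesis, the ratio is `F`-distributed and
independent of the other summaries of the data. -/
theorem ratio_law_and_indep (hq : 1 ≤ q) {mean : Fin n → EuclideanSpace ℝ (Fin q)} {σ : ℝ}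
    (hσ : 0 < σ) {ξ : Ω → Points n q} (hξ : HasLaw ξ (stdGaussian (Points n q)) P)
    {k k' : Fin K} (hkk' : k ≠ k') {c : Clustering n K} (hc : NullOutcome k k' mean c)
    {x : Ω → Matrix (Fin n) (Fin q) ℝ}
    (hx : ∀ ω, x ω = Matrix.of (fun i j => mean i j) + σ • toMat (ξ ω)) :
    HasLaw (fun ω => ratio c k k' (x ω)) (refDist q c k k') P ∧
    IndepFun (fun ω => fixedVars c k k' (x ω)) (fun ω => ratio c k k' (x ω)) P ∧
    ∀ᵐ ω ∂P, 0 < frob (proj0 c k k' * x ω) ∧ 0 < frob (proj1 c k k' * x ω) := by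
  obtain ⟨hk, hk', hm, hnull⟩ := hc
  obtain ⟨U, hU, hU'⟩ := exists_orthonormal_rows (d := 1) (A := proj0 c k k') proj0_transpose
    (proj0_mul_self hkk' hk hk') (by simpa using trace_proj0 hkk' hk hk')
  obtain ⟨V, hV, hV'⟩ := exists_orthonormal_rows (d := pairSize c k k' - 2) (A := proj1 c k k')
    proj1_transpose (proj1_mul_self hkk' hk hk')
    (by rw [trace_proj1 hk hk', Nat.cast_sub (by omega)]; rfl)
  have : Nonempty (Fin q) := ⟨⟨0, hq⟩⟩
  have : Nonempty (Fin (pairSize c k k' - 2)) := ⟨⟨0, by omega⟩⟩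
  -- Inserting U Uᵀ = 1 and V Vᵀ = 1 produces the product P₀ P₁ in the middle; the next two
  -- identities use the same device.
  have hUV : U * V.transpose = 0 := by
    calc U * V.transpose = (U * U.transpose) * U * V.transpose * (V * V.transpose) := by
          rw [hU, hV, Matrix.one_mul, Matrix.mul_one]
      _ = U * ((U.transpose * U) * (V.transpose * V)) * V.transpose := by
          simp only [Matrix.mul_assoc]
      _ = 0 := by rw [hU', hV', proj0_mul_proj1 hkk' hk hk']; simp
  have hUW : U * (proj2 c k k').transpose = 0 := by
    calc U * (proj2 c k k').transpose = U * ((U.transpose * U) * proj2 c k k') := by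
          rw [proj2_transpose, ← Matrix.mul_assoc, ← Matrix.mul_assoc, hU, Matrix.one_mul]
      _ = 0 := by rw [hU', proj0_mul_proj2 hkk' hk hk']; simp
  have hVW : V * (proj2 c k k').transpose = 0 := by
    calc V * (proj2 c k k').transpose = V * ((V.transpose * V) * proj2 c k k') := by
          rw [proj2_transpose, ← Matrix.mul_assoc, ← Matrix.mul_assoc, hV, Matrix.one_mul]
      _ = 0 := by rw [hV', proj1_mul_proj2 hkk' hk hk']; simp
  -- `A` and `B` are the coordinates of the noise in the ranges of P₀ and P₁, of dimensions q and (m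
  -- - 2)q; `C` is its P₂ part.
  obtain ⟨A, hAdef⟩ : ∃ A : Ω → Points 1 q, ∀ ω, A ω = rowMap q U (ξ ω) := ⟨_, fun _ => rfl⟩
  obtain ⟨B, hBdef⟩ : ∃ B : Ω → Points (pairSize c k k' - 2) q, ∀ ω, B ω = rowMap q V (ξ ω) :=
    ⟨_, fun _ => rfl⟩
  obtain ⟨C, hCdef⟩ : ∃ C : Ω → Points n q, ∀ ω, C ω = rowMap q (proj2 c k k') (ξ ω) :=
    ⟨_, fun _ => rfl⟩
  have hA : HasLaw A (stdGaussian (Points 1 q)) P := by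
    rw [funext hAdef]; exact hasLaw_rowMap hξ hU
  have hB : HasLaw B (stdGaussian (Points (pairSize c k k' - 2) q)) P := by
    rw [funext hBdef]; exact hasLaw_rowMap hξ hV
  have hCm : AEMeasurable C P := by
    rw [funext hCdef]; exact aemeasurable_rowMap hξ.aemeasurable _
  have hAB : IndepFun A B P := by
    rw [funext hAdef, funext hBdef]; exact indepFun_rowMap hξ hUV
  have hCAB : IndepFun C (fun ω => (A ω, B ω)) P := by
    simp_rw [funext hCdef, hAdef, hBdef]; exact indepFun_rowMap_prodMk hξ hUW hVW
  -- Under the null hypothesis P₀ and P₁ remove the mean, leaving pure noise of scale σ; P₂ retains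
  -- it as a constant shift.
  have hP0 : ∀ ω, proj0 c k k' * x ω = σ • (U.transpose * toMat (A ω)) := by
    intro ω
    rw [hx, Matrix.mul_add, proj0_mul_mean hk hk' hnull, zero_add, Matrix.mul_smul, hAdef, toMat_rowMap,
      ← Matrix.mul_assoc, hU']
  have hP1 : ∀ ω, proj1 c k k' * x ω = σ • (V.transpose * toMat (B ω)) := by
    intro ω
    rw [hx, Matrix.mul_add, proj1_mul_mean hk hk' hnull, zero_add, Matrix.mul_smul, hBdef, toMat_rowMap,
      ← Matrix.mul_assoc, hV']
  have hP2 : ∀ ω, proj2 c k k' * x ω =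
      proj2 c k k' * Matrix.of (fun i j => mean i j) + σ • toMat (C ω) := by
    intro ω
    rw [hx, Matrix.mul_add, Matrix.mul_smul, hCdef, toMat_rowMap]
  have hF0 : ∀ ω, frob (proj0 c k k' * x ω) = σ * ‖A ω‖ := fun ω => by rw [hP0, frob_eq hU hσ]
  have hF1 : ∀ ω, frob (proj1 c k k' * x ω) = σ * ‖B ω‖ := fun ω => by rw [hP1, frob_eq hV hσ]
  have hR : ∀ ω, ratio c k k' (x ω) = ((pairSize c k k' : ℝ) - 2) * (‖A ω‖ ^ 2 / ‖B ω‖ ^ 2) := by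
    intro ω
    rw [ratio, hF0, hF1, mul_pow, mul_pow, mul_div_mul_left _ _ (by positivity)]
  refine ⟨?_, ?_, ?_⟩
  · have h := hasLaw_ratio hA hB hAB
    rw [finrank_points, finrank_points, one_mul] at h
    -- The factor m - 2 of the statistic is the quotient of the two degrees of freedom, (m - 2)q and
    -- q.
    have hfun : (fun ω => ratio c k k' (x ω)) = fun ω => (‖A ω‖ ^ 2 / (q : ℕ)) /
        (‖B ω‖ ^ 2 / (((pairSize c k k' - 2) * q : ℕ) : ℝ)) := by
      ext ω
      have hq0 : (q : ℝ) ≠ 0 := by positivity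
      rw [hR, Nat.cast_mul, Nat.cast_sub (by omega), div_div_div_eq, mul_comm (_ - _) (q : ℝ),
        mul_left_comm, mul_div_mul_left _ _ hq0]
      push_cast
      ring
    rw [hfun]
    exact h
  · have h := indepFun_ratio hA hB hCm hAB hCAB
    have hφ : Measurable
        (fun z : Points n q × ℝ × Points (pairSize c k k' - 2) q × Points 1 q =>
          (σ ^ 2 * z.2.1, U.transpose * toMat z.2.2.2, V.transpose * toMat z.2.2.1,
            proj2 c k k' * Matrix.of (fun i j => mean i j) + σ • toMat z.1)) := by
      refine (measurable_snd.fst.const_mul _).prodMk (.prodMk ?_ (.prodMk ?_ ?_))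
      · exact (measurable_matrix_mul _).comp (measurable_toMat.comp measurable_snd.snd.snd)
      · exact (measurable_matrix_mul _).comp (measurable_toMat.comp measurable_snd.snd.fst)
      · exact measurable_matrix_add.comp (measurable_const.prodMk (measurable_matrix_smul.comp
          (measurable_const.prodMk (measurable_toMat.comp measurable_fst))))
    have h' := h.comp hφ (measurable_const_mul ((pairSize c k k' : ℝ) - 2))
    convert h' using 1
    · ext1 ω
      simp only [fixedVars, Function.comp_apply, totalSq]
      rw [hF0, hF1, hP0, hP1, hP2, direction_eq hU hσ, direction_eq hV hσ]
      congr 1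
      ring
    · ext1 ω
      exact hR ω
  · filter_upwards [ae_ne_zero_of_hasLaw hA, ae_ne_zero_of_hasLaw hB] with ω h0 h1
    rw [hF0, hF1]
    exact ⟨mul_pos hσ (norm_pos_iff.2 h0), mul_pos hσ (norm_pos_iff.2 h1)⟩

open scoped MatrixOrder Matrix.Norms.L2Operator in
/-- The standardised points form a standard Gaussian vector. -/
theorem exists_standardized {mean : Fin n → EuclideanSpace ℝ (Fin q)} {σ : ℝ} (hσ : 0 < σ)
    {X : Fin n → Ω → EuclideanSpace ℝ (Fin q)}
    (hX : ∀ i, HasLaw (X i)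
      (multivariateGaussian (mean i) (σ ^ 2 • (1 : Matrix (Fin q) (Fin q) ℝ))) P)
    (hindep : iIndepFun X P) :
    ∃ ξ : Ω → Points n q, HasLaw ξ (stdGaussian (Points n q)) P ∧
      ∀ ω, dataMatrix X ω = Matrix.of (fun i j => mean i j) + σ • toMat (ξ ω) := by
  have hXm := fun i => (hX i).aemeasurable
  -- `multivariateGaussian` is the image of the standard Gaussian under the square root of the
  -- covariance, here σ times the identity.
  have hsqrt : CFC.sqrt (σ ^ 2 • (1 : Matrix (Fin q) (Fin q) ℝ)) =
      σ • (1 : Matrix (Fin q) (Fin q) ℝ) := by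
    refine CFC.sqrt_unique (by simp [smul_smul, sq]) ?_
    exact smul_nonneg hσ.le zero_le_one
  have hlaw : ∀ i, P.map (fun ω => σ⁻¹ • (X i ω - mean i)) =
      stdGaussian (EuclideanSpace ℝ (Fin q)) := by
    intro i
    have := AEMeasurable.map_map_of_aemeasurable
      (g := fun y : EuclideanSpace ℝ (Fin q) => σ⁻¹ • (y - mean i)) (by fun_prop) (hXm i)
    rw [(hX i).map_eq, multivariateGaussian, hsqrt, Measure.map_map (by fun_prop) (by fun_prop)]
      at this
    refine this.symm.trans ?_
    convert Measure.map_id using 2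
    ext1 y
    simp [smul_smul, inv_mul_cancel₀ hσ.ne']
  refine ⟨fun ω => WithLp.toLp 2 fun i => σ⁻¹ • (X i ω - mean i), ⟨by fun_prop, ?_⟩, fun ω => ?_⟩
  · have hI : iIndepFun (fun i ω => σ⁻¹ • (X i ω - mean i)) P :=
      hindep.comp (fun i y => σ⁻¹ • (y - mean i)) (fun i => by fun_prop)
    have hpi := (iIndepFun_iff_map_fun_eq_pi_map (fun i => by fun_prop)).1 hI
    simp_rw [hlaw] at hpi
    have hmap := AEMeasurable.map_map_of_aemeasurable (μ := P)
      (g := (WithLp.toLp 2 : (Fin n → EuclideanSpace ℝ (Fin q)) → Points n q))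
      (f := fun ω i => σ⁻¹ • (X i ω - mean i)) (by fun_prop) (by fun_prop)
    rw [hpi] at hmap
    refine hmap.symm.trans ?_
    have : IsProbabilityMeasure ((Measure.pi fun _ : Fin n =>
        stdGaussian (EuclideanSpace ℝ (Fin q))).map
          (WithLp.toLp 2 : (Fin n → EuclideanSpace ℝ (Fin q)) → Points n q)) :=
      Measure.isProbabilityMeasure_map (by fun_prop)
    apply Measure.ext_of_charFun
    ext t
    simp_rw [charFun_pi, charFun_stdGaussian, ← Complex.exp_sum, ← Complex.ofReal_pow,
      PiLp.norm_sq_eq_of_L2]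
    simp [Finset.sum_div, neg_div]
  · ext i j
    simp [dataMatrix, toMat, mul_inv_cancel_left₀ hσ.ne']

end Model

/-! ### Truncation by selection on a pair of independent variables. -/

section Selection

variable {β : Type*} [MeasurableSpace β]

/-- Writes the truncated law through masses of slices, which depend measurably on `z`. A null slice
gives the zero measure, since ∞ · 0 = 0. -/
theorem cond_map_apply (F : Measure ℝ) {S : Set (β × ℝ)} (hS : MeasurableSet S)
    {f : β × ℝ → ℝ} (hf : Measurable f) {s : Set ℝ} (hs : MeasurableSet s) (z : β) :
    ((F[|Prod.mk z ⁻¹' S]).map (fun r => f (z, r))) s =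
      (F (Prod.mk z ⁻¹' S))⁻¹ * F (Prod.mk z ⁻¹' (S ∩ f ⁻¹' s)) := by
  have hfz : Measurable fun r => f (z, r) := hf.comp measurable_prodMk_left
  rw [Measure.map_apply hfz hs, cond_apply (measurable_prodMk_left hS)]
  rfl

theorem measurable_cond_map (F : Measure ℝ) [SFinite F] {S : Set (β × ℝ)} (hS : MeasurableSet S)
    {f : β × ℝ → ℝ} (hf : Measurable f) :
    Measurable (fun z => (F[|Prod.mk z ⁻¹' S]).map (fun r => f (z, r))) := by
  refine Measure.measurable_of_measurable_coe _ fun s hs => ?_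
  simp_rw [cond_map_apply F hS hf hs]
  exact (measurable_measure_prodMk_left hS).inv.mul
    (measurable_measure_prodMk_left (hS.inter (hf hs)))

/-- The evaluation point is made a parameter too: the numerator is the mass of a slice, at the pair,
of a measurable set with one further real coordinate. -/
theorem measurable_one_sub_cond_real (F : Measure ℝ) [SFinite F] {S : Set (β × ℝ)}
    (hS : MeasurableSet S) :
    Measurable (fun p : β × ℝ => 1 - (F[|Prod.mk p.1 ⁻¹' S]).real (Iic p.2)) := by
  have hle : MeasurableSet {w : (β × ℝ) × ℝ | w.2 ≤ w.1.2} :=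
    measurableSet_le measurable_snd measurable_fst.snd
  have hpre : MeasurableSet ((fun w : (β × ℝ) × ℝ => (w.1.1, w.2)) ⁻¹' S) :=
    (measurable_fst.fst.prodMk measurable_snd) hS
  have h : ∀ p : β × ℝ, (F[|Prod.mk p.1 ⁻¹' S]) (Iic p.2) = (F (Prod.mk p.1 ⁻¹' S))⁻¹ *
      F (Prod.mk p ⁻¹' ((fun w : (β × ℝ) × ℝ => (w.1.1, w.2)) ⁻¹' S ∩
        {w : (β × ℝ) × ℝ | w.2 ≤ w.1.2})) := fun p => by
    rw [cond_apply (measurable_prodMk_left hS)]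
    rfl
  simp_rw [measureReal_def, h]
  exact (((measurable_measure_prodMk_left hS).comp measurable_fst).inv.mul
    (measurable_measure_prodMk_left (hpre.inter hle))).ennreal_toReal.const_sub 1

variable {Ω : Type*} [MeasurableSpace Ω] {P : Measure Ω} [IsProbabilityMeasure P]
  {F : Measure ℝ} {Z : Ω → β} {R : Ω → ℝ} {S : Set (β × ℝ)}

theorem map_prodMk_eq_prod (hZ : AEMeasurable Z P) (hR : HasLaw R F P) (hind : IndepFun Z R P) :
    P.map (fun ω => (Z ω, R ω)) = (P.map Z).prod F := by
  rw [(indepFun_iff_map_prod_eq_prod_map_map hZ hR.aemeasurable).1 hind, hR.map_eq]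

variable [IsProbabilityMeasure F]

/-- Selecting on `(Z, R) ∈ S` truncates the law `F` of `R` to the slice of `S` at `Z`. -/
theorem map_restrict_eq_compProd (hZ : AEMeasurable Z P) (hR : HasLaw R F P)
    (hind : IndepFun Z R P) (hS : MeasurableSet S) {f : β × ℝ → ℝ} (hf : Measurable f)
    {t : Set β} (ht : MeasurableSet t) {s : Set ℝ} (hs : MeasurableSet s) :
    P.map (fun ω => (Z ω, R ω)) (S ∩ (Prod.fst ⁻¹' t ∩ f ⁻¹' s)) =
      ∫⁻ p in S ∩ Prod.fst ⁻¹' t, ((F[|Prod.mk p.1 ⁻¹' S]).map (fun r => f (p.1, r))) s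
        ∂P.map (fun ω => (Z ω, R ω)) := by
  have := Measure.isProbabilityMeasure_map hZ
  have hκ : Measurable fun z => ((F[|Prod.mk z ⁻¹' S]).map (fun r => f (z, r))) s :=
    (Measure.measurable_coe hs).comp (measurable_cond_map F hS hf)
  have hκ' : Measurable fun p : β × ℝ =>
      ((F[|Prod.mk p.1 ⁻¹' S]).map (fun r => f (p.1, r))) s := hκ.comp measurable_fst
  have htm : MeasurableSet (Prod.fst ⁻¹' t : Set (β × ℝ)) := measurable_fst ht
  rw [map_prodMk_eq_prod hZ hR hind, Measure.prod_apply (hS.inter (htm.inter (hf hs))),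
    ← lintegral_indicator (hS.inter htm),
    lintegral_prod _ (hκ'.indicator (hS.inter htm)).aemeasurable]
  refine lintegral_congr fun z => ?_
  by_cases hz : z ∈ t
  · have h1 : Prod.mk z ⁻¹' (S ∩ (Prod.fst ⁻¹' t ∩ f ⁻¹' s)) =
        Prod.mk z ⁻¹' (S ∩ f ⁻¹' s) := by
      ext r; simp [hz]
    have h2 : ∀ r, (S ∩ Prod.fst ⁻¹' t).indicator (fun p : β × ℝ =>
        ((F[|Prod.mk p.1 ⁻¹' S]).map (fun r => f (p.1, r))) s) (z, r) =
        (Prod.mk z ⁻¹' S).indicator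
          (fun _ => ((F[|Prod.mk z ⁻¹' S]).map (fun r => f (z, r))) s) r := by
      intro r
      by_cases hr : (z, r) ∈ S
      · rw [indicator_of_mem (show (z, r) ∈ S ∩ Prod.fst ⁻¹' t from ⟨hr, hz⟩),
          indicator_of_mem (show r ∈ Prod.mk z ⁻¹' S from hr)]
      · rw [indicator_of_notMem (fun h => hr h.1),
          indicator_of_notMem (show r ∉ Prod.mk z ⁻¹' S from hr)]
    simp_rw [h1, h2]
    rw [lintegral_indicator (measurable_prodMk_left hS), setLIntegral_const,
      cond_map_apply F hS hf hs]
    -- Null slices contribute nothing to either side; otherwise the mass of the slice cancels the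
    -- normalising constant.
    by_cases h0 : F (Prod.mk z ⁻¹' S) = 0
    · rw [h0, mul_zero]
      exact measure_mono_null (fun r hr => hr.1) h0
    · rw [mul_right_comm, ENNReal.inv_mul_cancel h0 (measure_ne_top _ _), one_mul]
  · have h1 : Prod.mk z ⁻¹' (S ∩ (Prod.fst ⁻¹' t ∩ f ⁻¹' s)) = ∅ := by
      ext r; simp [hz]
    have h2 : ∀ r, (S ∩ Prod.fst ⁻¹' t).indicator (fun p : β × ℝ =>
        ((F[|Prod.mk p.1 ⁻¹' S]).map (fun r => f (p.1, r))) s) (z, r) = 0 :=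
      fun r => indicator_of_notMem (fun h => hz h.2) _
    simp_rw [h1, h2]
    simp

/-- By Fubini, the points of `S` lying over null slices form a null set. Hence truncation at the
observed slice yields a probability measure. -/
theorem ae_slice_ne_zero (hZ : AEMeasurable Z P) (hR : HasLaw R F P) (hind : IndepFun Z R P)
    (hS : MeasurableSet S) : ∀ᵐ ω ∂P, (Z ω, R ω) ∈ S → F (Prod.mk (Z ω) ⁻¹' S) ≠ 0 := by
  have := Measure.isProbabilityMeasure_map hZ
  have hR' := hR.aemeasurable
  have hm : MeasurableSet {z | F (Prod.mk z ⁻¹' S) = 0} :=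
    measurable_measure_prodMk_left hS (measurableSet_singleton 0)
  have hm' : MeasurableSet (Prod.fst ⁻¹' {z | F (Prod.mk z ⁻¹' S) = 0} : Set (β × ℝ)) :=
    measurable_fst hm
  refine ae_of_ae_map (p := fun p : β × ℝ => p ∈ S → F (Prod.mk p.1 ⁻¹' S) ≠ 0)
    (hZ.prodMk hR') ?_
  rw [map_prodMk_eq_prod hZ hR hind, ae_iff]
  have hset : {p : β × ℝ | ¬(p ∈ S → F (Prod.mk p.1 ⁻¹' S) ≠ 0)} =
      S ∩ Prod.fst ⁻¹' {z | F (Prod.mk z ⁻¹' S) = 0} := by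
    ext p; simp
  rw [hset, Measure.measure_prod_null (hS.inter hm')]
  refine Filter.Eventually.of_forall fun z => ?_
  by_cases hz : F (Prod.mk z ⁻¹' S) = 0
  · exact measure_mono_null (fun r hr => hr.1) hz
  · have hempty : Prod.mk z ⁻¹' (S ∩ Prod.fst ⁻¹' {z | F (Prod.mk z ⁻¹' S) = 0}) = ∅ := by
      ext r
      simp only [mem_preimage, mem_inter_iff, mem_empty_iff_false, iff_false, not_and]
      exact fun _ h => hz h
    exact (congrArg F hempty).trans measure_empty

variable {ι : Type*} [MeasurableSpace ι] [MeasurableSingletonClass ι]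

/-- Conditional law of `Y` given `Z' = (outcome, Z)` where the outcome is `c`, when this event is
`(Z, R) ∈ S` and `Y = f (Z, R)` on it. -/
theorem condDistrib_of_selection (hZ : AEMeasurable Z P) (hR : HasLaw R F P)
    (hind : IndepFun Z R P) (hS : MeasurableSet S) {f : β × ℝ → ℝ} (hf : Measurable f)
    {Z' : Ω → ι × β} {Y : Ω → ℝ} (hZ' : AEMeasurable Z' P) (hY : AEMeasurable Y P) {c : ι}
    (hsel : ∀ᵐ ω ∂P, (Z' ω).1 = c ↔ (Z ω, R ω) ∈ S)
    (hZc : ∀ ω, (Z' ω).1 = c → (Z' ω).2 = Z ω) (hYc : ∀ ω, (Z' ω).1 = c → Y ω = f (Z ω, R ω)) :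
    ∀ᵐ ω ∂P, (Z' ω).1 = c → condDistrib Y Z' P (Z' ω) =
      (F[|Prod.mk (Z ω) ⁻¹' S]).map (fun r => f (Z ω, r)) := by
  classical
  have hR' := hR.aemeasurable
  let κ₀ : Kernel β ℝ := ⟨_, measurable_cond_map F hS hf⟩
  have hκ₀ : ∀ z, κ₀ z = (F[|Prod.mk z ⁻¹' S]).map (fun r => f (z, r)) := fun _ => rfl
  have hfin : IsFiniteKernel κ₀ := ⟨1, ENNReal.one_lt_top, fun z => by
    rw [hκ₀, cond_map_apply F hS hf .univ, preimage_univ, inter_univ]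
    exact ENNReal.inv_mul_le_one _⟩
  have hD : MeasurableSet (Prod.fst ⁻¹' {c} : Set (ι × β)) :=
    measurable_fst (measurableSet_singleton c)
  -- The claim concerns the outcome `c` alone, so the candidate kernel keeps the true conditional
  -- law for all other outcomes. It disintegrates the joint law, and uniqueness of disintegration
  -- concludes.
  let κ : Kernel (ι × β) ℝ := Kernel.piecewise hD (κ₀.comap Prod.snd measurable_snd)
    (condDistrib Y Z' P)
  have hκc : ∀ w : ι × β, w.1 = c → κ w = κ₀ w.2 := fun w hw => by
    rw [Kernel.piecewise_apply, if_pos (by exact hw)]; rfl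
  have hκn : ∀ w : ι × β, w.1 ≠ c → κ w = condDistrib Y Z' P w := fun w hw => by
    rw [Kernel.piecewise_apply, if_neg (by exact hw)]
  have hmain : P.map (fun ω => (Z' ω, Y ω)) = P.map Z' ⊗ₘ κ := by
    have hprob := Measure.isProbabilityMeasure_map hZ'
    have hprob' := Measure.isProbabilityMeasure_map (hZ'.prodMk hY)
    refine Measure.ext_prod (fun {t s} ht hs => ?_)
    have hout : P.map (fun ω => (Z' ω, Y ω)) ((t \ Prod.fst ⁻¹' {c}) ×ˢ s) =
        ∫⁻ w in t \ Prod.fst ⁻¹' {c}, κ w s ∂P.map Z' := by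
      rw [← compProd_map_condDistrib hY, Measure.compProd_apply_prod (ht.diff hD) hs]
      refine setLIntegral_congr_fun (ht.diff hD) fun w hw => ?_
      rw [hκn w (fun h => hw.2 h)]
    have hin : P.map (fun ω => (Z' ω, Y ω)) ((t ∩ Prod.fst ⁻¹' {c}) ×ˢ s) =
        ∫⁻ w in t ∩ Prod.fst ⁻¹' {c}, κ w s ∂P.map Z' := by
      have htc : MeasurableSet (Prod.mk c ⁻¹' t) := measurable_prodMk_left ht
      have hS' : MeasurableSet (S ∩ Prod.fst ⁻¹' (Prod.mk c ⁻¹' t)) :=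
        hS.inter (measurable_fst htc)
      have hκm : Measurable fun p : β × ℝ =>
          ((F[|Prod.mk p.1 ⁻¹' S]).map (fun r => f (p.1, r))) s :=
        (κ₀.measurable_coe hs).comp measurable_fst
      have hkey := map_restrict_eq_compProd hZ hR hind hS hf htc hs
      rw [Measure.map_apply_of_aemeasurable (hZ.prodMk hR')
        (hS.inter ((measurable_fst htc).inter (hf hs))), ← lintegral_indicator hS',
        lintegral_map' (hκm.indicator hS').aemeasurable (hZ.prodMk hR')] at hkey
      rw [Measure.map_apply_of_aemeasurable (hZ'.prodMk hY) ((ht.inter hD).prod hs),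
        ← lintegral_indicator (ht.inter hD),
        lintegral_map' ((κ.measurable_coe hs).indicator (ht.inter hD)).aemeasurable hZ']
      have hmem : ∀ ω, (Z' ω).1 = c → (Z' ω ∈ t ↔ Z ω ∈ Prod.mk c ⁻¹' t) := fun ω h => by
        rw [mem_preimage, ← h, ← hZc ω h]
      refine (measure_congr ?_).trans (hkey.trans (lintegral_congr_ae ?_))
      · filter_upwards [hsel] with ω hω
        refine propext ⟨fun h => ?_, fun h => ?_⟩
        · have hc : (Z' ω).1 = c := h.1.2
          exact ⟨hω.1 hc, (hmem ω hc).1 h.1.1, by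
            have := h.2
            simp only [hYc ω hc] at this
            exact this⟩
        · have hc : (Z' ω).1 = c := hω.2 h.1
          refine ⟨⟨(hmem ω hc).2 h.2.1, hc⟩, ?_⟩
          simp only [hYc ω hc]
          exact h.2.2
      · filter_upwards [hsel] with ω hω
        by_cases hc : (Z' ω).1 = c
        · by_cases ht' : Z' ω ∈ t
          · rw [indicator_of_mem (show (Z ω, R ω) ∈ S ∩ Prod.fst ⁻¹' (Prod.mk c ⁻¹' t) from
              ⟨hω.1 hc, (hmem ω hc).1 ht'⟩),
              indicator_of_mem (show Z' ω ∈ t ∩ Prod.fst ⁻¹' {c} from ⟨ht', hc⟩), hκc _ hc, hκ₀,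
              hZc ω hc]
          · rw [indicator_of_notMem (fun h => ht' ((hmem ω hc).2 h.2)),
              indicator_of_notMem (fun h => ht' h.1)]
        · rw [indicator_of_notMem (fun h => hc (hω.2 h.1)),
            indicator_of_notMem (fun h => hc h.2)]
    rw [Measure.compProd_apply_prod ht hs, ← lintegral_inter_add_sdiff _ t hD, ← hin, ← hout,
      ← measure_union _ ((ht.diff hD).prod hs), ← union_prod, inter_union_sdiff]
    exact (disjoint_sdiff_inter.symm).set_prod_left _ _
  have h := ae_of_ae_map hZ' (condDistrib_ae_eq_of_measure_eq_compProd Z' hY hmain)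
  filter_upwards [h] with ω hω hc
  rw [hω, hκc _ hc, hκ₀, hZc ω hc]

end Selection

/-! ### Rebuilding the data from the conditioning variables and the ratio. -/

section Reconstruction

variable {n q K : ℕ} {c : Clustering n K} {k k' : Fin K}

/-- The data with given conditioning variables and given value `r` of the ratio. -/
noncomputable def recompose (c : Clustering n K) (k k' : Fin K)
    (p : (ℝ × Matrix (Fin n) (Fin q) ℝ × Matrix (Fin n) (Fin q) ℝ × Matrix (Fin n) (Fin q) ℝ) × ℝ) :
    Matrix (Fin n) (Fin q) ℝ :=
  √p.1.1 • (√(p.2 / ((pairSize c k k' : ℝ) - 2 + p.2)) • p.1.2.1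
    + √(((pairSize c k k' : ℝ) - 2) / ((pairSize c k k' : ℝ) - 2 + p.2)) • p.1.2.2.1) + p.1.2.2.2

/-- The perturbed data depend on `x` only through the conditioning variables, which is why S' is
determined by them. -/
theorem recompose_fixedVars (x : Matrix (Fin n) (Fin q) ℝ) (r : ℝ) :
    recompose c k k' (fixedVars c k k' x, r) = perturbed c k k' x r := rfl

theorem measurable_recompose : Measurable (recompose (n := n) (q := q) c k k') := by
  refine measurable_matrix_add.comp (.prodMk ?_ measurable_fst.snd.snd.snd)
  refine measurable_matrix_smul.comp (measurable_fst.fst.sqrt.prodMk ?_)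
  refine measurable_matrix_add.comp (.prodMk ?_ ?_)
  · exact measurable_matrix_smul.comp
      ((measurable_snd.div (measurable_snd.const_add _)).sqrt.prodMk measurable_fst.snd.fst)
  · exact measurable_matrix_smul.comp
      ((measurable_const.div (measurable_snd.const_add _)).sqrt.prodMk measurable_fst.snd.snd.fst)

theorem ratio_pos (hm : 3 ≤ pairSize c k k') {x : Matrix (Fin n) (Fin q) ℝ}
    (h0 : 0 < frob (proj0 c k k' * x)) (h1 : 0 < frob (proj1 c k k' * x)) :
    0 < ratio c k k' x := by
  have hm' : (3 : ℝ) ≤ pairSize c k k' := by exact_mod_cast hm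
  have : (0 : ℝ) < (pairSize c k k' : ℝ) - 2 := by linarith
  rw [ratio]
  positivity

/-- With a, b the two norms and r = (m - 2)a²/b², the square roots equal a/√(a² + b²) and b/√(a² +
b²), so the formula collapses to P₀x + P₁x + P₂x. Both norms must be nonzero for the directions to
be recovered. -/
theorem perturbed_ratio (hm : 3 ≤ pairSize c k k') {x : Matrix (Fin n) (Fin q) ℝ}
    (h0 : 0 < frob (proj0 c k k' * x)) (h1 : 0 < frob (proj1 c k k' * x)) :
    perturbed c k k' x (ratio c k k' x) = x := by
  have hm' : (3 : ℝ) ≤ pairSize c k k' := by exact_mod_cast hm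
  simp only [perturbed, ratio, totalSq, direction]
  set d : ℝ := (pairSize c k k' : ℝ) - 2 with hd
  set a := frob (proj0 c k k' * x)
  set b := frob (proj1 c k k' * x)
  have hdpos : 0 < d := by linarith
  have e0 : d * (a ^ 2 / b ^ 2) / (d + d * (a ^ 2 / b ^ 2)) = a ^ 2 / (a ^ 2 + b ^ 2) := by
    field_simp
    ring
  have e1 : d / (d + d * (a ^ 2 / b ^ 2)) = b ^ 2 / (a ^ 2 + b ^ 2) := by
    field_simp
    ring
  have hs : 0 < √(a ^ 2 + b ^ 2) := Real.sqrt_pos.2 (by positivity)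
  rw [e0, e1, Real.sqrt_div (sq_nonneg a), Real.sqrt_div (sq_nonneg b), Real.sqrt_sq h0.le,
    Real.sqrt_sq h1.le, smul_add, smul_smul, smul_smul, smul_smul, smul_smul]
  have f0 : √(a ^ 2 + b ^ 2) * (a / √(a ^ 2 + b ^ 2)) * a⁻¹ = 1 := by field_simp
  have f1 : √(a ^ 2 + b ^ 2) * (b / √(a ^ 2 + b ^ 2)) * b⁻¹ = 1 := by field_simp
  rw [f0, f1, one_smul, one_smul, ← Matrix.add_mul, ← Matrix.add_mul,
    proj2]
  simp

end Reconstruction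

/-! ### Measurability of the statistic, the p-value and the selection set. -/

section Measurability

variable {n q K : ℕ}

theorem measurable_fixedVars (c : Clustering n K) (k k' : Fin K) :
    Measurable (fixedVars (q := q) c k k') := by
  have h0 := measurable_matrix_mul (q := q) (proj0 c k k')
  have h1 := measurable_matrix_mul (q := q) (proj1 c k k')
  exact (((measurable_frob.comp h0).pow_const 2).add ((measurable_frob.comp h1).pow_const 2)).prodMk
    ((measurable_direction.comp h0).prodMk ((measurable_direction.comp h1).prodMk
      (measurable_matrix_mul _)))

theorem measurable_ratio (c : Clustering n K) (k k' : Fin K) :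
    Measurable (ratio (q := q) c k k') := by
  have h0 := measurable_matrix_mul (q := q) (proj0 c k k')
  have h1 := measurable_matrix_mul (q := q) (proj1 c k k')
  exact (((measurable_frob.comp h0).pow_const 2).div
    ((measurable_frob.comp h1).pow_const 2)).const_mul _

variable {Cluster : Matrix (Fin n) (Fin q) ℝ → Clustering n K}

/-- The outcomes form a countable discrete space, so it is enough to check each fixed outcome. -/
theorem measurable_of_forall_outcome {γ : Type*} [MeasurableSpace γ] (hCluster : Measurable Cluster)
    {g : Clustering n K → Matrix (Fin n) (Fin q) ℝ → γ} (hg : ∀ c, Measurable (g c)) :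
    Measurable fun x => g (Cluster x) x :=
  (measurable_from_prod_countable_right (f := fun p : Clustering n K × _ => g p.1 p.2) hg).comp
    (hCluster.prodMk measurable_id)

theorem measurable_statR (hCluster : Measurable Cluster) (k k' : Fin K) :
    Measurable (statR Cluster k k') :=
  measurable_of_forall_outcome hCluster fun c => measurable_ratio c k k'

theorem measurable_condVars (hCluster : Measurable Cluster) (k k' : Fin K) :
    Measurable (condVars Cluster k k') :=
  hCluster.prodMk (measurable_of_forall_outcome hCluster fun c => measurable_fixedVars c k k')

/-- The pairs of conditioning variables and values of the ratio for which the outcome is `c`. -/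
def selectionSet (Cluster : Matrix (Fin n) (Fin q) ℝ → Clustering n K) (k k' : Fin K)
    (c : Clustering n K) :
    Set ((ℝ × Matrix (Fin n) (Fin q) ℝ × Matrix (Fin n) (Fin q) ℝ × Matrix (Fin n) (Fin q) ℝ)
      × ℝ) :=
  {p | 0 < p.2 ∧ c = Cluster (recompose c k k' p)}

theorem measurableSet_selectionSet (hCluster : Measurable Cluster) (k k' : Fin K)
    (c : Clustering n K) : MeasurableSet (selectionSet Cluster k k' c) :=
  (measurableSet_lt measurable_const measurable_snd).inter
    (measurableSet_eq_fun measurable_const (hCluster.comp measurable_recompose))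

theorem slice_selectionSet {k k' : Fin K} {c : Clustering n K} {x : Matrix (Fin n) (Fin q) ℝ}
    (hx : Cluster x = c) :
    Prod.mk (fixedVars c k k' x) ⁻¹' selectionSet Cluster k k' c = truncSet Cluster k k' x := by
  subst hx
  rfl

/-- The p-value as a function of the conditioning variables and of the ratio. -/
noncomputable def outcomePValue (Cluster : Matrix (Fin n) (Fin q) ℝ → Clustering n K)
    (k k' : Fin K) (c : Clustering n K)
    (p : (ℝ × Matrix (Fin n) (Fin q) ℝ × Matrix (Fin n) (Fin q) ℝ × Matrix (Fin n) (Fin q) ℝ)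
      × ℝ) : ℝ :=
  1 - ((refDist q c k k')[|Prod.mk p.1 ⁻¹' selectionSet Cluster k k' c]).real (Iic p.2)

instance isProbabilityMeasure_refDist (q : ℕ) (c : Clustering n K) (k k' : Fin K) :
    IsProbabilityMeasure (refDist q c k k') :=
  isProbabilityMeasure_fDist _ _

theorem measurable_outcomePValue (hCluster : Measurable Cluster) (k k' : Fin K)
    (c : Clustering n K) : Measurable (outcomePValue Cluster k k' c) :=
  measurable_one_sub_cond_real _ (measurableSet_selectionSet hCluster k k' c)

theorem pValue_eq {k k' : Fin K} {c : Clustering n K} {x : Matrix (Fin n) (Fin q) ℝ}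
    (hx : Cluster x = c) :
    pValue Cluster k k' x = outcomePValue Cluster k k' c (fixedVars c k k' x, ratio c k k' x) := by
  subst hx
  rfl

theorem measurable_pValue (hCluster : Measurable Cluster) (k k' : Fin K) :
    Measurable (pValue Cluster k k') := by
  have h : pValue Cluster k k' = fun x =>
      outcomePValue Cluster k k' (Cluster x) (fixedVars (Cluster x) k k' x, ratio (Cluster x) k k' x) :=
    funext fun x => pValue_eq rfl
  rw [h]
  exact measurable_of_forall_outcome
    (g := fun c x => outcomePValue Cluster k k' c (fixedVars c k k' x, ratio c k k' x))
    hCluster fun c => (measurable_outcomePValue hCluster k k' c).comp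
      ((measurable_fixedVars c k k').prodMk (measurable_ratio c k k'))

end Measurability

/-! ### From a constant conditional law to the law given an event. -/

section ConditionalUniform

variable {Ω β : Type*} [MeasurableSpace Ω] [MeasurableSpace β] {P : Measure Ω}
  [IsProbabilityMeasure P]

/-- A variable with the same conditional law `μ` on the whole event `{Z ∈ D}` has law `μ`
given this event. -/
theorem hasLaw_cond_of_condDistrib {Z : Ω → β} {Y : Ω → ℝ} (hZ : AEMeasurable Z P)
    (hY : AEMeasurable Y P) {D : Set β} (hD : MeasurableSet D) {μ : Measure ℝ}
    (h : ∀ᵐ ω ∂P, Z ω ∈ D → condDistrib Y Z P (Z ω) = μ) (hPD : P (Z ⁻¹' D) ≠ 0) :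
    HasLaw Y μ (P[|Z ⁻¹' D]) where
  aemeasurable := hY.mono_ac cond_absolutelyContinuous
  map_eq := by
    have hnull : NullMeasurableSet (Z ⁻¹' D) P := hZ.nullMeasurableSet_preimage hD
    ext s hs
    -- Integrate the conditional law over `D`, where it is constantly `μ`.
    have hset : P.map (fun ω => (Z ω, Y ω)) (D ×ˢ s) = P (Z ⁻¹' D) * μ s := by
      rw [← compProd_map_condDistrib hY, Measure.compProd_apply_prod hD hs,
        ← Measure.map_apply_of_aemeasurable hZ hD, mul_comm, ← setLIntegral_const]
      refine lintegral_congr_ae ?_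
      rw [Filter.EventuallyEq, ae_restrict_iff' hD, ae_map_iff hZ]
      · filter_upwards [h] with ω hω hmem
        rw [hω hmem]
      · have : {w | w ∈ D → condDistrib Y Z P w s = μ s} =
            Dᶜ ∪ {w | condDistrib Y Z P w s = μ s} := by
          ext w; simp [imp_iff_not_or]
        rw [this]
        exact hD.compl.union ((Kernel.measurable_coe _ hs) (measurableSet_singleton _))
    rw [Measure.map_apply_of_aemeasurable (hZ.prodMk hY) (hD.prod hs)] at hset
    rw [Measure.map_apply_of_aemeasurable (hY.mono_ac cond_absolutelyContinuous) hs, ProbabilityTheory.cond,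
      Measure.smul_apply, smul_eq_mul, Measure.restrict_apply₀' hnull, inter_comm]
    change (P (Z ⁻¹' D))⁻¹ * P (Z ⁻¹' D ∩ Y ⁻¹' s) = μ s
    rw [show Z ⁻¹' D ∩ Y ⁻¹' s = (fun ω => (Z ω, Y ω)) ⁻¹' D ×ˢ s from rfl, hset, ← mul_assoc,
      ENNReal.inv_mul_cancel hPD (measure_ne_top _ _), one_mul]

end ConditionalUniform

end ClusterTest

/-! ### The main theorem. -/

theorem theorem2 {Ω : Type*} [MeasurableSpace Ω] (P : Measure Ω) [IsProbabilityMeasure P]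
    {n q K : ℕ} (hq : 1 ≤ q)
    (mean : Fin n → EuclideanSpace ℝ (Fin q)) (σ : ℝ) (hσ : 0 < σ)
    (X : Fin n → Ω → EuclideanSpace ℝ (Fin q))
    (hX : ∀ i, HasLaw (X i) (multivariateGaussian (mean i) (σ ^ 2 • (1 : Matrix (Fin q) (Fin q) ℝ))) P)
    (hindep : iIndepFun X P)
    (Cluster : Matrix (Fin n) (Fin q) ℝ → Clustering n K) (hCluster : Measurable Cluster)
    (k k' : Fin K) (hkk' : k ≠ k') :
    -- the conditional law of `R` is the truncated F distribution
    (∀ᵐ ω ∂P, NullOutcome k k' mean (Cluster (dataMatrix X ω)) →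
      condDistrib (fun ω => statR Cluster k k' (dataMatrix X ω))
          (fun ω => condVars Cluster k k' (dataMatrix X ω)) P
          (condVars Cluster k k' (dataMatrix X ω)) =
        truncated (refDist q (Cluster (dataMatrix X ω)) k k')
          (truncSet Cluster k k' (dataMatrix X ω))) ∧
    -- the p-value is uniform given the conditioning variables
    (∀ᵐ ω ∂P, NullOutcome k k' mean (Cluster (dataMatrix X ω)) →
      condDistrib (fun ω => pValue Cluster k k' (dataMatrix X ω))
          (fun ω => condVars Cluster k k' (dataMatrix X ω)) P
          (condVars Cluster k k' (dataMatrix X ω)) =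
        volume.restrict (Icc (0 : ℝ) 1)) ∧
    -- the p-value is uniform given any event about the outcome on which the null holds
    (∀ A : Set (Clustering n K), (∀ c ∈ A, NullOutcome k k' mean c) →
      P {ω | Cluster (dataMatrix X ω) ∈ A} ≠ 0 →
      HasLaw (fun ω => pValue Cluster k k' (dataMatrix X ω)) (volume.restrict (Icc (0 : ℝ) 1))
        (P[|{ω | Cluster (dataMatrix X ω) ∈ A}])) := by
  obtain ⟨ξ, hξ, hx⟩ := exists_standardized hσ hX hindep
  have hxm : AEMeasurable (dataMatrix X) P := by
    rw [funext hx]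
    exact (measurable_matrix_add.comp (measurable_const.prodMk (measurable_matrix_smul.comp
      (measurable_const.prodMk measurable_toMat)))).comp_aemeasurable hξ.aemeasurable
  have hZ' := (measurable_condVars hCluster k k').comp_aemeasurable hxm
  have hRm := (measurable_statR hCluster k k').comp_aemeasurable hxm
  have hPm := (measurable_pValue hCluster k k').comp_aemeasurable hxm
  -- Only almost sure, since the reconstruction requires both projected matrices to be nonzero.
  have hsel : ∀ c, NullOutcome k k' mean c → ∀ᵐ ω ∂P, Cluster (dataMatrix X ω) = c ↔
      (fixedVars c k k' (dataMatrix X ω), ratio c k k' (dataMatrix X ω)) ∈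
        selectionSet Cluster k k' c := by
    intro c hc
    filter_upwards [(ratio_law_and_indep hq hσ hξ hkk' hc hx).2.2] with ω hω
    rw [selectionSet, mem_ofPred_eq, recompose_fixedVars, perturbed_ratio hc.2.2.1 hω.1 hω.2]
    exact ⟨fun h => ⟨ratio_pos hc.2.2.1 hω.1 hω.2, h.symm⟩, fun h => h.2.symm⟩
  have h1 : ∀ᵐ ω ∂P, ∀ c, NullOutcome k k' mean c → Cluster (dataMatrix X ω) = c →
      condDistrib (fun ω => statR Cluster k k' (dataMatrix X ω))
          (fun ω => condVars Cluster k k' (dataMatrix X ω)) P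
          (condVars Cluster k k' (dataMatrix X ω)) =
        truncated (refDist q c k k') (truncSet Cluster k k' (dataMatrix X ω)) := by
    rw [ae_all_iff]
    intro c
    by_cases hc : NullOutcome k k' mean c
    · obtain ⟨hR, hind, -⟩ := ratio_law_and_indep hq hσ hξ hkk' hc hx
      have hZ := (measurable_fixedVars c k k').comp_aemeasurable hxm
      -- The function of (Z, R) is the second projection, so the pushforward of the truncated law is
      -- the truncated law itself.
      filter_upwards [condDistrib_of_selection hZ hR hind
        (measurableSet_selectionSet hCluster k k' c) measurable_snd hZ' hRm (hsel c hc)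
        (fun ω hω => by
          change (Cluster (dataMatrix X ω)) = c at hω
          change (condVars Cluster k k' (dataMatrix X ω)).2 = fixedVars c k k' (dataMatrix X ω)
          subst hω; rfl)
        (fun ω hω => by
          change (Cluster (dataMatrix X ω)) = c at hω
          change ratio (Cluster (dataMatrix X ω)) k k' (dataMatrix X ω) = _
          subst hω; rfl)] with ω hω _ hcω
      refine (hω hcω).trans ?_
      have hslice := slice_selectionSet (k := k) (k' := k') hcω
      simp only [Function.comp_apply, hslice]
      exact Measure.map_id
    · exact Filter.Eventually.of_forall fun ω h => absurd h hc
  have h2 : ∀ᵐ ω ∂P, ∀ c, NullOutcome k k' mean c → Cluster (dataMatrix X ω) = c →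
      condDistrib (fun ω => pValue Cluster k k' (dataMatrix X ω))
          (fun ω => condVars Cluster k k' (dataMatrix X ω)) P
          (condVars Cluster k k' (dataMatrix X ω)) = volume.restrict (Icc (0 : ℝ) 1) := by
    rw [ae_all_iff]
    intro c
    by_cases hc : NullOutcome k k' mean c
    · obtain ⟨hR, hind, -⟩ := ratio_law_and_indep hq hσ hξ hkk' hc hx
      have hZ := (measurable_fixedVars c k k').comp_aemeasurable hxm
      have hS := measurableSet_selectionSet hCluster k k' c
      have hm := hc.2.2.1
      -- Both degrees of freedom, q and (m - 2)q, are positive because q ≥ 1 and m ≥ 3.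
      have hatom : NullSingletonClass (refDist q c k k') :=
        nullSingletonClass_fDist (by omega) (Nat.mul_ne_zero (by omega) (by omega))
      filter_upwards [condDistrib_of_selection hZ hR hind hS
        (measurable_outcomePValue hCluster k k' c) hZ' hPm (hsel c hc)
        (fun ω hω => by
          change (Cluster (dataMatrix X ω)) = c at hω
          change (condVars Cluster k k' (dataMatrix X ω)).2 = fixedVars c k k' (dataMatrix X ω)
          subst hω; rfl)
        (fun ω hω => pValue_eq hω), ae_slice_ne_zero hZ hR hind hS, hsel c hc]
        with ω hω hne hselω _ hcω
      refine (hω hcω).trans ?_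
      have : IsProbabilityMeasure ((refDist q c k k')[|Prod.mk (fixedVars c k k' (dataMatrix X ω)) ⁻¹'
          selectionSet Cluster k k' c]) := cond_isProbabilityMeasure (hne (hselω.1 hcω))
      have : NullSingletonClass ((refDist q c k k')[|Prod.mk (fixedVars c k k' (dataMatrix X ω)) ⁻¹'
          selectionSet Cluster k k' c]) :=
        ⟨fun r => cond_absolutelyContinuous (measure_singleton r)⟩
      -- With the conditioning variables held fixed, the p-value is one minus the distribution
      -- function of the truncated law, evaluated at a variable with that same law.
      exact map_one_sub_cdf ((refDist q c k k')[|Prod.mk (fixedVars c k k' (dataMatrix X ω)) ⁻¹'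
        selectionSet Cluster k k' c])
    · exact Filter.Eventually.of_forall fun ω h => absurd h hc
  refine ⟨?_, ?_, fun A hA hPA => ?_⟩
  · filter_upwards [h1] with ω hω hc using hω _ hc rfl
  · filter_upwards [h2] with ω hω hc using hω _ hc rfl
  · have hD : MeasurableSet (Prod.fst ⁻¹' A :
        Set (Clustering n K × ℝ × Matrix (Fin n) (Fin q) ℝ × Matrix (Fin n) (Fin q) ℝ ×
          Matrix (Fin n) (Fin q) ℝ)) := measurable_fst A.toFinite.measurableSet
    refine hasLaw_cond_of_condDistrib hZ' hPm hD ?_ hPA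
    filter_upwards [h2] with ω hω hmem using hω _ (hA _ hmem) rfl
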